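/- **Setting.** For $(x,y)\in\mathbb R^2$ put $M(x,y)=\max\{|x|,|y|\}$, and for $(x,y)\in[-\frac\pi2,\frac\pi2]^2$ put $$h(x,y)=\left(\frac{x\sin M(x,y)}{\sqrt{x^2+y^2}},\ \frac{y\sin M(x,y)}{\sqrt{x^2+y^2}},\ \cos M(x,y)\right),\qquad h(0,0)=(0,0,1).$$ Let $Z:\mathbb R^3\to\mathbb R^3\setminus\{0\}$ be the Zorich map: $Z(x,y,z)=e^z h(x,y)$ on $[-\frac\pi2,\frac\pi2]^2\times\mathbb R$, extended to $\mathbb R^3$ by repeated reflection in the planes $x=(k+\frac12)\pi$ and $y=(l+\frac12)\pi$ ($k,l\in\mathbb Z$) in the domain and in the plane $z=0$ in the image. Let $A:\mathbb R^3\to\mathbb R^3\cup\{\infty\}$ be the Möbius map $$A(x,y,z)=(2rx,\,2ry,\,1-2r(z+1)),\qquad r=\frac1{x^2+y^2+(z+1)^2},\qquad A(0,0,-1)=\infty.$$ The generalized tangent map $T:\mathbb R^3\to\mathbb R^3\cup\{\infty\}$ is $T(\mathbf x)=A(Z(2\mathbf x))$, and for $\lambda>0$ we put $T_\lambda=\lambda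 T$ (with $\lambda\cdot\infty=\infty$). The iterate $T_\lambda^{k}(\mathbf x)$ is defined as long as $T_\lambda^{j}(\mathbf x)\neq\infty$ for all $j<k$. The backward orbit of infinity and the escaping set are $$O^-(\infty)=\bigcup_{k=1}^\infty T_\lambda^{-k}(\infty)\subseteq\mathbb R^3,\qquad I(T_\lambda)=\{\mathbf x\in\mathbb R^3\setminus O^-(\infty): T_\lambda^k(\mathbf x)\to\infty\text{ as }k\to\infty\}.$$ **Theorem 2.2.** For every $\lambda>0$, $$\overline{I(T_\lambda)}=\overline{O^-(\infty)},$$ where the closures are taken in $\mathbb R^3$. Moreover, $I(T_\lambda)$ is uncountable, totally disconnected and has no isolated points. -/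

import Mathlib

open Filter Topology OnePoint

noncomputable section

namespace QRTangent

/-! ## Iteration of maps `f : E → E ∪ {∞}` -/

section Iteration

variable {E : Type*}

/-- The `k`-th iterate of `f : E → E ∪ {∞}`, as a partial function: `f^0` is the inclusion, and
`f^(k+1) (x) = f (f^k (x))` is undefined if `f^k (x)` is undefined or equal to `∞`. -/
def iter (f : E → OnePoint E) : ℕ → E →. OnePoint E
  | 0 => fun x => Part.some (x : OnePoint E)
  | k + 1 => fun x =>
      (iter f k x).bind fun p => p.elim Part.none fun y => Part.some (f y)

/-- The backward orbit of infinity, `O⁻(∞) = ⋃_{k ≥ 1} f^{-k}(∞)`, a subset of `E`. -/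
def backwardOrbitInfty (f : E → OnePoint E) : Set E :=
  {x | ∃ k : ℕ, 1 ≤ k ∧ ∞ ∈ iter f k x}

/-- The escaping set: the points outside `O⁻(∞)` whose iterates (which are then all defined)
tend to `∞` in the one-point compactification. -/
def escapingSet [TopologicalSpace E] (f : E → OnePoint E) : Set E :=
  {x | x ∉ backwardOrbitInfty f ∧
    ∃ u : ℕ → OnePoint E, (∀ k, u k ∈ iter f k x) ∧ Tendsto u atTop (𝓝 ∞)}

end Iteration

/-! ## The generalized tangent map of `ℝ³` -/

/-- Euclidean `ℝ³`. -/
abbrev E3 : Type := EuclideanSpace ℝ (Fin 3)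

/-- `M(x, y) = max {|x|, |y|}`. -/
def M (x y : ℝ) : ℝ := max |x| |y|

/-- The bi-Lipschitz map `h` from the square `[-π/2, π/2]²` onto the closed upper unit hemisphere.
At the origin the quotients are `0 / 0 = 0`, which gives the right value `h(0, 0) = (0, 0, 1)`. -/
def h (x y : ℝ) : E3 :=
  !₂[x * Real.sin (M x y) / Real.sqrt (x ^ 2 + y ^ 2),
     y * Real.sin (M x y) / Real.sqrt (x ^ 2 + y ^ 2),
     Real.cos (M x y)]

/-- The (parity of the) number of reflections in the points `(j + 1/2) π`, `j ∈ ℤ`, which take `t`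
into `[-π/2, π/2]`: the integer `k` with `|t - k π| ≤ π/2`. -/
def foldIndex (t : ℝ) : ℤ := round (t / Real.pi)

/-- The point of `[-π/2, π/2]` obtained from `t` by repeated reflection in the points
`(j + 1/2) π`, `j ∈ ℤ`. -/
def fold (t : ℝ) : ℝ := (-1) ^ foldIndex t * (t - foldIndex t * Real.pi)

/-- The Zorich map of `ℝ³`: it is `e^z h(x, y)` on the beam `[-π/2, π/2]² × ℝ`, extended by
repeated reflection in the planes `x = (j + 1/2) π` and `y = (j + 1/2) π` in the domain and in the
plane `z = 0` in the image (one change of sign of the third coordinate for each reflection). -/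
def zorich (v : E3) : E3 :=
  let w : E3 := h (fold (v 0)) (fold (v 1))
  Real.exp (v 2) • !₂[w 0, w 1, (-1) ^ (foldIndex (v 0) + foldIndex (v 1)) * w 2]

/-- The Möbius map `A(x, y, z) = (2 r x, 2 r y, 1 - 2 r (z + 1))` with
`r = 1 / (x² + y² + (z + 1)²)`; its pole is `(0, 0, -1)`. -/
def moebius (v : E3) : OnePoint E3 :=
  if v = !₂[0, 0, -1] then ∞
  else
    let r : ℝ := 1 / ((v 0) ^ 2 + (v 1) ^ 2 + (v 2 + 1) ^ 2)
    ((!₂[2 * r * v 0, 2 * r * v 1, 1 - 2 * r * (v 2 + 1)] : E3) : OnePoint E3)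

/-- The generalized tangent map `T(v) = A(Z(2 v))`. -/
def T (v : E3) : OnePoint E3 := moebius (zorich ((2 : ℝ) • v))

/-- `T_c = c T`, for a real `c`, with `c ∞ = ∞`. -/
def scaledT (c : ℝ) (v : E3) : OnePoint E3 := OnePoint.map (fun w : E3 => c • w) (T v)

end QRTangent

end

/-! Since `|Z(2v)| = exp (2 v₂)`, the plane `z = 0` is exactly the preimage of the unit sphere,
which `A` projects stereographically onto that plane. The plane is therefore completely invariant
and contains all poles. It also contains every escaping orbit: a point with a distant image is near
the plane, and its height is at least doubled (`height_of_scaledT_eq`), so a nonzero height could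
not stay bounded. Everything reduces to the planar map `planarT`.

The sup-norm squares of side `π/2` centred at `(π/2)ℤ²` form a checkerboard. Even squares map
homeomorphically onto the closed disk of radius `c`, with radial profile `c tan`, and odd squares
onto its exterior together with `∞`, with profile `c cot`. The inverse branches of odd squares
contract by `1/2` far from the origin (`dist_branch_le`), so a tail of an escaping orbit is
determined by the odd squares that it visits.

Pulling poles back along such a tail approximates an escaping point by `O⁻(∞)`. Conversely,
compactness realizes prescribed itineraries by orbits. Binary choices in them give uncountably many
escaping points, and arbitrarily distant ones, whose preimages accumulate at each pole. Openness of
the map transports both approximations backwards, so the closures agree. As the two sets are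
disjoint, the escaping set has no isolated points.

For total disconnectedness, the escaping set is cut into countably many closed pieces on which
itinerary cylinders form a clopen basis. The countable sum theorem of dimension theory then applies.
-/

noncomputable section

namespace QRTangent

/-! ### Orbits of partially defined maps and transfer to an invariant subset -/

section Iteration

variable {E : Type*} {f : E → OnePoint E}

theorem mem_iter_succ {k : ℕ} {x : E} {p : OnePoint E} :
    p ∈ iter f (k + 1) x ↔ ∃ y : E, (y : OnePoint E) ∈ iter f k x ∧ p = f y := by
  simp only [iter, Part.mem_bind_iff]
  constructor
  · rintro ⟨q, hq, hp⟩
    induction q using OnePoint.rec with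
    | infty => exact absurd hp (Part.notMem_none p)
    | coe y => exact ⟨y, hq, by simpa using hp⟩
  · rintro ⟨y, hy, rfl⟩
    exact ⟨y, hy, by simp⟩

/-- The recursion defining `iter` splits off the last step, whereas pulling back needs the first
one. The second alternative is an orbit that ends at `∞` after a single step. -/
theorem mem_iter_succ_left {k : ℕ} {x : E} {p : OnePoint E} :
    p ∈ iter f (k + 1) x ↔
      (∃ y : E, f x = y ∧ p ∈ iter f k y) ∨ (f x = ∞ ∧ k = 0 ∧ p = ∞) := by
  induction k generalizing p with
  | zero =>
    rw [mem_iter_succ]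
    simp only [iter, Part.mem_some_iff, OnePoint.coe_eq_coe]
    constructor
    · rintro ⟨y, rfl, rfl⟩
      rcases hy : f y with _ | z
      · exact Or.inr ⟨rfl, trivial, rfl⟩
      · exact Or.inl ⟨z, rfl, rfl⟩
    · rintro (⟨y, hy, rfl⟩ | ⟨hx, -, rfl⟩)
      · exact ⟨x, rfl, hy.symm⟩
      · exact ⟨x, rfl, hx.symm⟩
  | succ k ih =>
    rw [mem_iter_succ]
    constructor
    · rintro ⟨y, hy, rfl⟩
      rcases ih.1 hy with ⟨z, hz, hyz⟩ | ⟨-, -, hy'⟩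
      · exact Or.inl ⟨z, hz, mem_iter_succ.2 ⟨y, hyz, rfl⟩⟩
      · exact absurd hy' (OnePoint.coe_ne_infty y)
    · rintro (⟨z, hz, hp⟩ | ⟨-, hk, -⟩)
      · obtain ⟨y, hy, rfl⟩ := mem_iter_succ.1 hp
        exact ⟨y, ih.2 (Or.inl ⟨z, hz, hy⟩), rfl⟩
      · exact absurd hk (Nat.succ_ne_zero k)

theorem backwardOrbitInfty_of_pole {x : E} (hx : f x = ∞) : x ∈ backwardOrbitInfty f :=
  ⟨1, le_rfl, mem_iter_succ_left.2 (Or.inr ⟨hx, rfl, rfl⟩)⟩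

theorem backwardOrbitInfty_of_preimage {x y : E} (hx : f x = y)
    (hy : y ∈ backwardOrbitInfty f) : x ∈ backwardOrbitInfty f := by
  obtain ⟨k, -, hk⟩ := hy
  exact ⟨k + 1, by omega, mem_iter_succ_left.2 (Or.inl ⟨y, hx, hk⟩)⟩

theorem backwardOrbitInfty_induction {P : E → Prop} (hpole : ∀ x, f x = ∞ → P x)
    (hpre : ∀ x y : E, f x = y → y ∈ backwardOrbitInfty f → P y → P x) {x : E}
    (hx : x ∈ backwardOrbitInfty f) : P x := by
  obtain ⟨k, hk, hx⟩ := hx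
  induction k generalizing x with
  | zero => omega
  | succ k ih =>
    rcases mem_iter_succ_left.1 hx with ⟨y, hy, hm⟩ | ⟨h, -, -⟩
    · rcases Nat.eq_zero_or_pos k with rfl | hk'
      · exact absurd (Part.mem_some_iff.1 hm).symm (OnePoint.coe_ne_infty y)
      · exact hpre x y hy ⟨k, hk', hm⟩ (ih hk' hm)
    · exact hpole x h

theorem orbit_mem_iter {u : ℕ → E} (hu : ∀ k, f (u k) = u (k + 1)) (k : ℕ) :
    (u k : OnePoint E) ∈ iter f k (u 0) := by
  induction k with
  | zero => exact Part.mem_some _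
  | succ k ih => exact mem_iter_succ.2 ⟨u k, ih, (hu k).symm⟩

theorem orbit_unique {u v : ℕ → E} (hu : ∀ k, f (u k) = u (k + 1))
    (hv : ∀ k, f (v k) = v (k + 1)) (h0 : u 0 = v 0) : u = v := by
  funext k
  induction k with
  | zero => exact h0
  | succ k ih => exact OnePoint.coe_injective (by rw [← hu, ← hv, ih])

variable [TopologicalSpace E] [T2Space E]

/-- The escaping set in terms of genuine orbits. -/
theorem mem_escapingSet_iff {x : E} :
    x ∈ escapingSet f ↔ ∃ u : ℕ → E, u 0 = x ∧ (∀ k, f (u k) = u (k + 1)) ∧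
      Tendsto u atTop (cocompact E) := by
  have key : ∀ u : ℕ → E, Tendsto u atTop (cocompact E) ↔
      Tendsto (fun k => (u k : OnePoint E)) atTop (𝓝 ∞) := by
    intro u
    rw [← coclosedCompact_eq_cocompact, ← OnePoint.comap_coe_nhds_infty, tendsto_comap_iff]
    rfl
  constructor
  · rintro ⟨hx, u, hu, hlim⟩
    have hne : ∀ k, ∃ y : E, (y : OnePoint E) = u k := by
      intro k
      rw [← OnePoint.ne_infty_iff_exists]
      intro hk
      rcases Nat.eq_zero_or_pos k with rfl | hk'
      · exact absurd ((Part.mem_some_iff.1 (hu 0)).symm.trans hk) (OnePoint.coe_ne_infty x)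
      · exact hx ⟨k, hk', hk ▸ hu k⟩
    choose v hv using hne
    refine ⟨v, OnePoint.coe_injective ((hv 0).trans (Part.mem_some_iff.1 (hu 0))), fun k => ?_, ?_⟩
    · obtain ⟨y, hy, hy'⟩ := mem_iter_succ.1 (hu (k + 1))
      obtain rfl : y = v k := OnePoint.coe_injective ((Part.mem_unique hy (hu k)).trans (hv k).symm)
      rw [hv (k + 1), hy']
    · rw [key]
      simpa only [hv] using hlim
  · rintro ⟨u, rfl, hu, hlim⟩
    refine ⟨?_, fun k => u k, orbit_mem_iter hu, (key u).1 hlim⟩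
    rintro ⟨k, -, hk⟩
    exact OnePoint.infty_ne_coe _ (Part.mem_unique hk (orbit_mem_iter hu k))

theorem escapingSet_of_preimage {x y : E} (hx : f x = y) (hy : y ∈ escapingSet f) :
    x ∈ escapingSet f := by
  obtain ⟨u, rfl, hu, hlim⟩ := mem_escapingSet_iff.1 hy
  refine mem_escapingSet_iff.2 ⟨fun k => Nat.casesOn k x u, rfl, fun k => ?_, ?_⟩
  · cases k with
    | zero => exact hx
    | succ k => exact hu k
  · exact (tendsto_add_atTop_iff_nat 1).1 hlim

/-- Both inclusions are inductions from the poles: `hpole` and `hpre` keep every backward step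
inside the range of `ι`, and `hconj` translates it. -/
theorem backwardOrbitInfty_eq_image {E P : Type*} {f : E → OnePoint E} {t : P → OnePoint P}
    {ι : P → E}
    (hconj : ∀ p, f (ι p) = OnePoint.map ι (t p)) (hpole : ∀ v, f v = ∞ → v ∈ Set.range ι)
    (hpre : ∀ v p, f v = ι p → v ∈ Set.range ι) (hι : Function.Injective ι) :
    backwardOrbitInfty f = ι '' backwardOrbitInfty t := by
  have hcoe : ∀ p q, f (ι p) = ι q → t p = q := by
    intro p q hpq
    rw [hconj] at hpq
    exact Option.map_injective hι hpq
  apply Set.Subset.antisymm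
  · intro v hv
    refine backwardOrbitInfty_induction (P := fun v => v ∈ ι '' backwardOrbitInfty t) ?_ ?_ hv
    · intro v hv
      obtain ⟨p, rfl⟩ := hpole v hv
      refine ⟨p, backwardOrbitInfty_of_pole ?_, rfl⟩
      rw [hconj] at hv
      exact Option.map_injective hι hv
    · rintro v w hvw - ⟨q, hq, rfl⟩
      obtain ⟨p, rfl⟩ := hpre v q hvw
      exact ⟨p, backwardOrbitInfty_of_preimage (hcoe _ _ hvw) hq, rfl⟩
  · rintro _ ⟨p, hp, rfl⟩
    refine backwardOrbitInfty_induction (P := fun p => ι p ∈ backwardOrbitInfty f) ?_ ?_ hp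
    · intro p hp
      exact backwardOrbitInfty_of_pole (by rw [hconj, hp]; rfl)
    · intro p q hpq _ hq
      exact backwardOrbitInfty_of_preimage (by rw [hconj, hpq]; rfl) hq

theorem escapingSet_eq_image {P : Type*} [TopologicalSpace P] [T2Space P]
    {t : P → OnePoint P} {ι : P → E}
    (hconj : ∀ p, f (ι p) = OnePoint.map ι (t p)) (hι : IsClosedEmbedding ι)
    (hesc : ∀ u : ℕ → E, (∀ k, f (u k) = u (k + 1)) → Tendsto u atTop (cocompact E) →
      ∀ k, u k ∈ Set.range ι) :
    escapingSet f = ι '' escapingSet t := by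
  ext v
  constructor
  · intro hv
    obtain ⟨u, rfl, hu, hlim⟩ := mem_escapingSet_iff.1 hv
    choose w hw using hesc u hu hlim
    refine ⟨w 0, mem_escapingSet_iff.2 ⟨w, rfl, fun k => ?_, ?_⟩, hw 0⟩
    · have := hu k
      rw [← hw, ← hw, hconj] at this
      exact Option.map_injective hι.injective this
    -- Escape in `E` implies escape in `P` by continuity of `ι` alone; the converse below needs `ι`
    -- to be a closed embedding.
    · refine Tendsto.mono_right (tendsto_comap_iff.2 ?_) (comap_cocompact_le hι.continuous)
      simpa only [Function.comp_def, hw] using hlim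
  · rintro ⟨p, hp, rfl⟩
    obtain ⟨w, rfl, hw, hlim⟩ := mem_escapingSet_iff.1 hp
    refine mem_escapingSet_iff.2 ⟨fun k => ι (w k), rfl, fun k => ?_,
      hι.tendsto_cocompact.comp hlim⟩
    rw [hconj, hw]
    rfl

end Iteration

/-! ### Zero-dimensionality and the countable sum theorem -/

/-- A second countable space with a basis of clopen sets is strongly zero-dimensional. -/
theorem exists_isClopen_of_disjoint {Y : Type*} [TopologicalSpace Y] [SecondCountableTopology Y]
    (hY : ∀ (y : Y) (U : Set Y), IsOpen U → y ∈ U → ∃ C, IsClopen C ∧ y ∈ C ∧ C ⊆ U)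
    {A B : Set Y} (hA : IsClosed A) (hB : IsClosed B) (hAB : Disjoint A B) :
    ∃ C, IsClopen C ∧ A ⊆ C ∧ Disjoint C B := by
  have hpiece : ∀ y : Y, ∃ C, IsClopen C ∧ y ∈ C ∧ (Disjoint C A ∨ Disjoint C B) := by
    intro y
    by_cases hy : y ∈ A
    · obtain ⟨C, hC, hyC, hCU⟩ := hY y Bᶜ hB.isOpen_compl (Set.disjoint_left.1 hAB hy)
      exact ⟨C, hC, hyC, Or.inr (Set.disjoint_left.2 fun z hz => hCU hz)⟩
    · obtain ⟨C, hC, hyC, hCU⟩ := hY y Aᶜ hA.isOpen_compl hy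
      exact ⟨C, hC, hyC, Or.inl (Set.disjoint_left.2 fun z hz => hCU hz)⟩
  choose C hC hyC hCAB using hpiece
  obtain ⟨s, hs, hcov⟩ := TopologicalSpace.countable_cover_nhds
    fun y => (hC y).isOpen.mem_nhds (hyC y)
  rcases s.eq_empty_or_nonempty with rfl | hne
  · refine ⟨∅, isClopen_empty, fun y _ => ?_, Set.empty_disjoint _⟩
    have : y ∈ (⋃ x ∈ (∅ : Set Y), C x) := hcov ▸ Set.mem_univ y
    simp at this
  obtain ⟨e, rfl⟩ := hs.exists_eq_range hne
  -- A countable clopen partition, each part missing `A` or `B`. Any union of parts is clopen, its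
  -- complement being the union of the others.
  let D : ℕ → Set Y := disjointed fun n => C (e n)
  have hDcl : ∀ n, IsClopen (D n) := fun n =>
    disjointedRec (p := IsClopen) (fun _ i ht => ht.diff (hC (e i))) (hC (e n))
  have hDsub : ∀ n, D n ⊆ C (e n) := fun n => disjointed_subset (fun n => C (e n)) n
  have hDcov : ∀ y, ∃ n, y ∈ D n := by
    intro y
    have : y ∈ ⋃ n, D n := by
      have h1 : y ∈ (⋃ x ∈ Set.range e, C x) := hcov ▸ Set.mem_univ y
      rwa [Set.biUnion_range, ← iUnion_disjointed] at h1
    exact Set.mem_iUnion.1 this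
  have hDdisj : ∀ {m n y}, y ∈ D m → y ∈ D n → m = n := by
    intro m n y hm hn
    by_contra hmn
    exact Set.disjoint_left.1 (disjoint_disjointed (fun n => C (e n)) hmn) hm hn
  let S : Set ℕ := {n | Disjoint (D n) B}
  refine ⟨⋃ n ∈ S, D n, ⟨?_, isOpen_biUnion fun n _ => (hDcl n).isOpen⟩, ?_, ?_⟩
  · have : (⋃ n ∈ S, D n) = (⋃ n ∈ Sᶜ, D n)ᶜ := by
      ext y
      obtain ⟨n, hn⟩ := hDcov y
      simp only [Set.mem_iUnion, Set.mem_compl_iff, exists_prop, not_exists, not_and]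
      constructor
      · rintro ⟨m, hm, hym⟩ k hk hyk
        exact hk (hDdisj hym hyk ▸ hm)
      · intro hy
        exact ⟨n, by_contra fun hS => hy n hS hn, hn⟩
    rw [this]
    exact (isOpen_biUnion fun n _ => (hDcl n).isOpen).isClosed_compl
  · intro y hy
    obtain ⟨n, hn⟩ := hDcov y
    refine Set.mem_biUnion (x := n) ?_ hn
    rcases hCAB (e n) with h | h
    · exact absurd hy (Set.disjoint_left.1 h (hDsub n hn))
    · exact h.mono_left (hDsub n)
  · exact Set.disjoint_iUnion₂_left.2 fun n hn => hn

/-- The countable sum theorem: a second countable normal space which is a countable union of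
closed subspaces with clopen bases is totally disconnected. -/
theorem totallyDisconnectedSpace_of_iUnion_closed {X : Type*} [TopologicalSpace X]
    [T4Space X] [SecondCountableTopology X] {F : ℕ → Set X} (hF : ∀ n, IsClosed (F n))
    (hcov : ∀ x, ∃ n, x ∈ F n)
    (hzero : ∀ n (y : F n) (U : Set (F n)), IsOpen U → y ∈ U →
      ∃ C, IsClopen C ∧ y ∈ C ∧ C ⊆ U) :
    TotallyDisconnectedSpace X := by
  -- A pair with disjoint closures is enlarged to an open pair with disjoint closures that covers `F
  -- n`: a clopen set `C` of `F n` separates the traces, and its two sides are added to the closures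
  -- before normality is applied twice.
  have hstep : ∀ (n : ℕ) (p : {p : Set X × Set X // Disjoint (closure p.1) (closure p.2)}),
      ∃ q : {p : Set X × Set X // Disjoint (closure p.1) (closure p.2)},
        IsOpen q.1.1 ∧ IsOpen q.1.2 ∧ p.1.1 ⊆ q.1.1 ∧ p.1.2 ⊆ q.1.2 ∧
          F n ⊆ q.1.1 ∪ q.1.2 := by
    rintro n ⟨⟨K, L⟩, hKL⟩
    obtain ⟨C, hC, hKC, hCL⟩ := exists_isClopen_of_disjoint (hzero n)
      (A := Subtype.val ⁻¹' closure K) (B := Subtype.val ⁻¹' closure L)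
      (isClosed_closure.preimage continuous_subtype_val)
      (isClosed_closure.preimage continuous_subtype_val) (hKL.preimage _)
    have hc1 : IsClosed (closure K ∪ Subtype.val '' C) :=
      isClosed_closure.union ((hF n).isClosedEmbedding_subtypeVal.isClosedMap _ hC.isClosed)
    have hc2 : IsClosed (closure L ∪ Subtype.val '' Cᶜ) :=
      isClosed_closure.union
        ((hF n).isClosedEmbedding_subtypeVal.isClosedMap _ hC.compl.isClosed)
    have hdisj : Disjoint (closure K ∪ Subtype.val '' C) (closure L ∪ Subtype.val '' Cᶜ) := by
      rw [Set.disjoint_left]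
      rintro x (hx | ⟨y, hy, rfl⟩) (hx' | ⟨z, hz, hzx⟩)
      · exact Set.disjoint_left.1 hKL hx hx'
      · exact hz (hKC (hzx ▸ hx : z.1 ∈ closure K))
      · exact Set.disjoint_left.1 hCL hy hx'
      · exact hz (Subtype.val_injective hzx ▸ hy)
    obtain ⟨U, hU, hKU, hUL⟩ := normal_exists_closure_subset hc1 hc2.isOpen_compl
      (fun x hx => Set.disjoint_left.1 hdisj hx)
    obtain ⟨V, hV, hLV, hVU⟩ := normal_exists_closure_subset hc2
      (isClosed_closure (s := U)).isOpen_compl (fun x hx hxU => hUL hxU hx)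
    refine ⟨⟨(U, V), Set.disjoint_left.2 fun x hx hx' => hVU hx' hx⟩, hU, hV,
      fun x hx => hKU (Or.inl (subset_closure hx)), fun x hx => hLV (Or.inl (subset_closure hx)),
      fun x hx => ?_⟩
    by_cases hxC : (⟨x, hx⟩ : F n) ∈ C
    · exact Or.inl (hKU (Or.inr ⟨_, hxC, rfl⟩))
    · exact Or.inr (hLV (Or.inr ⟨_, hxC, rfl⟩))
  choose next hU hV hsub1 hsub2 hcov' using hstep
  have hsep : TotallySeparatedSpace X := by
    refine ⟨fun a _ b _ hab => ?_⟩
    let p : ℕ → {p : Set X × Set X // Disjoint (closure p.1) (closure p.2)} := fun n =>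
      Nat.rec ⟨({a}, {b}), by simpa using hab⟩ (fun n q => next n q) n
    have hmono1 : Monotone fun n => (p n).1.1 := monotone_nat_of_le_succ fun n => hsub1 n (p n)
    have hmono2 : Monotone fun n => (p n).1.2 := monotone_nat_of_le_succ fun n => hsub2 n (p n)
    -- The index starts at `1` because the initial pair of singletons need not be open.
    refine ⟨⋃ n, (p (n + 1)).1.1, ⋃ n, (p (n + 1)).1.2, isOpen_iUnion fun n => hU n (p n),
      isOpen_iUnion fun n => hV n (p n), Set.mem_iUnion.2 ⟨0, hsub1 0 (p 0) rfl⟩,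
      Set.mem_iUnion.2 ⟨0, hsub2 0 (p 0) rfl⟩, fun x _ => ?_, ?_⟩
    · obtain ⟨n, hn⟩ := hcov x
      rcases hcov' n (p n) hn with h | h
      · exact Or.inl (Set.mem_iUnion.2 ⟨n, h⟩)
      · exact Or.inr (Set.mem_iUnion.2 ⟨n, h⟩)
    · rw [Set.disjoint_left]
      intro x hx hx'
      obtain ⟨m, hm⟩ := Set.mem_iUnion.1 hx
      obtain ⟨n, hn⟩ := Set.mem_iUnion.1 hx'
      exact Set.disjoint_left.1 (p (max (m + 1) (n + 1))).2
        (subset_closure (hmono1 (le_max_left _ _) hm))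
        (subset_closure (hmono2 (le_max_right _ _) hn))
  infer_instance

/-! ### The Zorich map on the invariant plane -/

open Real

theorem neg_one_zpow_cases (k : ℤ) : (-1 : ℝ) ^ k = 1 ∨ (-1 : ℝ) ^ k = -1 := by
  rcases Int.even_or_odd k with hk | hk
  · exact Or.inl hk.neg_one_zpow
  · exact Or.inr hk.neg_one_zpow

theorem arcsin_sin_of_abs_sub_le {t : ℝ} {k : ℤ} (ht : |t - k * π| ≤ π / 2) :
    arcsin (sin t) = (-1) ^ k * (t - k * π) := by
  have h1 : sin t = sin ((-1) ^ k * (t - k * π)) := by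
    rcases neg_one_zpow_cases k with hk | hk
    · rw [hk, one_mul, sin_sub_int_mul_pi, hk, one_mul]
    · rw [hk, neg_one_mul, sin_neg, sin_sub_int_mul_pi, hk, neg_one_mul, neg_neg]
  rw [abs_le] at ht
  rw [h1]
  rcases neg_one_zpow_cases k with hk | hk <;> rw [hk] <;>
    exact arcsin_sin (by linarith) (by linarith)

theorem abs_sub_foldIndex_mul_pi_le (t : ℝ) : |t - foldIndex t * π| ≤ π / 2 := by
  have h := abs_sub_round (t / π)
  have h2 : t - foldIndex t * π = (t / π - round (t / π)) * π := by
    rw [foldIndex, sub_mul, div_mul_cancel₀ _ pi_ne_zero]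
  rw [h2, abs_mul, abs_of_pos pi_pos]
  nlinarith [pi_pos]

theorem fold_eq_arcsin_sin (t : ℝ) : fold t = arcsin (sin t) :=
  (arcsin_sin_of_abs_sub_le (abs_sub_foldIndex_mul_pi_le t)).symm

/-- At the reflection points two indices are admissible and `round` selects one. The expression
`arcsin (sin t)` does not depend on that choice, which lets closed squares be used later. -/
theorem fold_eq {t : ℝ} {k : ℤ} (ht : |t - k * π| ≤ π / 2) :
    fold t = (-1) ^ k * (t - k * π) := by
  rw [fold_eq_arcsin_sin, arcsin_sin_of_abs_sub_le ht]

theorem abs_neg_one_zpow_mul (k : ℤ) (x : ℝ) : |(-1) ^ k * x| = |x| := by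
  rcases neg_one_zpow_cases k with hk | hk <;> simp [hk]

theorem cos_eq_neg_one_zpow_mul (t : ℝ) (k : ℤ) :
    cos t = (-1) ^ k * cos (t - k * π) := by
  rw [cos_sub_int_mul_pi]
  rcases neg_one_zpow_cases k with hk | hk <;> simp [hk]

theorem cos_max_abs {a b : ℝ} (ha : |a| ≤ π / 2) (hb : |b| ≤ π / 2) :
    cos (max |a| |b|) = min (cos a) (cos b) := by
  have hanti : AntitoneOn cos (Set.Icc 0 π) := strictAntiOn_cos.antitoneOn
  have hpi := pi_pos
  rw [← cos_abs a, ← cos_abs b]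
  rcases le_total |a| |b| with hab | hab
  · rw [max_eq_right hab, min_eq_right]
    exact hanti ⟨abs_nonneg _, by linarith⟩ ⟨abs_nonneg _, by linarith⟩ hab
  · rw [max_eq_left hab, min_eq_left]
    exact hanti ⟨abs_nonneg _, by linarith⟩ ⟨abs_nonneg _, by linarith⟩ hab

/-- A formula for the third coordinate of the Zorich map that does not mention reflections. -/
theorem neg_one_zpow_mul_cos_max {s t : ℝ} {k l : ℤ} (hs : |s - k * π| ≤ π / 2)
    (ht : |t - l * π| ≤ π / 2) :
    (-1) ^ (k + l) * cos (max |s - k * π| |t - l * π|) =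
      (|cos s + cos t| - |cos s - cos t|) / 2 := by
  rw [cos_max_abs hs ht, cos_eq_neg_one_zpow_mul s k, cos_eq_neg_one_zpow_mul t l,
    zpow_add₀ (by norm_num)]
  have hu : 0 ≤ cos (s - k * π) := cos_nonneg_of_neg_pi_div_two_le_of_le
    (abs_le.1 hs).1 (abs_le.1 hs).2
  have hv : 0 ≤ cos (t - l * π) := cos_nonneg_of_neg_pi_div_two_le_of_le
    (abs_le.1 ht).1 (abs_le.1 ht).2
  generalize cos (s - k * π) = u at *
  generalize cos (t - l * π) = v at *
  have h1 : |u + v| = u + v := abs_of_nonneg (by positivity)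
  have h2 : min u v = (u + v - |u - v|) / 2 := by
    rcases le_total u v with huv | huv
    · rw [min_eq_left huv, abs_of_nonpos (by linarith)]; ring
    · rw [min_eq_right huv, abs_of_nonneg (by linarith)]; ring
  have h3 : |-u + v| = |u - v| := by rw [abs_sub_comm]; ring_nf
  have h4 : |-u - v| = u + v := by rw [← h1, ← abs_neg (u + v)]; ring_nf
  rcases neg_one_zpow_cases k with hk | hk <;> rcases neg_one_zpow_cases l with hl | hl <;>
    simp only [hk, hl, one_mul, neg_one_mul, sub_neg_eq_add, ← sub_eq_add_neg, mul_one, mul_neg,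
      neg_neg, h1, h2, h3, h4] <;> ring

/-- The Euclidean norm on `ℝ × ℝ` (whose own norm is the maximum norm). -/
def eucl (y : ℝ × ℝ) : ℝ := √(y.1 ^ 2 + y.2 ^ 2)

theorem eucl_nonneg (y : ℝ × ℝ) : 0 ≤ eucl y := Real.sqrt_nonneg _

theorem continuous_eucl : Continuous eucl := by unfold eucl; fun_prop

theorem eucl_smul {c : ℝ} (hc : 0 ≤ c) (y : ℝ × ℝ) : eucl (c • y) = c * eucl y := by
  simp only [eucl, Prod.smul_fst, Prod.smul_snd, smul_eq_mul]
  rw [show (c * y.1) ^ 2 + (c * y.2) ^ 2 = c ^ 2 * (y.1 ^ 2 + y.2 ^ 2) by ring,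
    Real.sqrt_mul (sq_nonneg c), Real.sqrt_sq hc]

theorem norm_eq_max (y : ℝ × ℝ) : ‖y‖ = max |y.1| |y.2| := rfl

theorem norm_le_eucl (y : ℝ × ℝ) : ‖y‖ ≤ eucl y := by
  rw [norm_eq_max]
  exact max_le (Real.abs_le_sqrt (by nlinarith [sq_nonneg y.2]))
    (Real.abs_le_sqrt (by nlinarith [sq_nonneg y.1]))

theorem eucl_le (y : ℝ × ℝ) : eucl y ≤ 2 * ‖y‖ := by
  have h1 : |y.1| ≤ ‖y‖ := le_max_left _ _
  have h2 : |y.2| ≤ ‖y‖ := le_max_right _ _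
  rw [eucl, Real.sqrt_le_left (by positivity), ← sq_abs y.1, ← sq_abs y.2]
  nlinarith [abs_nonneg y.1, abs_nonneg y.2]

theorem abs_eucl_sub_le (y z : ℝ × ℝ) : |eucl y - eucl z| ≤ 2 * ‖y - z‖ := by
  have htri : ∀ a b : ℝ × ℝ, eucl (a + b) ≤ eucl a + eucl b := by
    intro a b
    have hn : ∀ c : ℝ × ℝ, eucl c = ‖WithLp.toLp 2 c‖ := by
      intro c
      rw [WithLp.prod_norm_eq_of_L2]
      simp [eucl]
    rw [hn, hn, hn, WithLp.toLp_add]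
    exact norm_add_le _ _
  have h1 := htri (y - z) z
  have h2 := htri (z - y) y
  have h3 := eucl_le (y - z)
  have h4 := eucl_le (z - y)
  rw [norm_sub_rev] at h4
  rw [sub_add_cancel] at h1 h2
  rw [abs_le]
  constructor <;> linarith

theorem eucl_pos {y : ℝ × ℝ} (hy : y ≠ 0) : 0 < eucl y :=
  (norm_pos_iff.2 hy).trans_le (norm_le_eucl y)

/-! ### The planar map on the checkerboard of squares -/

/-- The restriction of `T_c` to the invariant plane `z = 0`. -/
def planarT (c : ℝ) (p : ℝ × ℝ) : OnePoint (ℝ × ℝ) :=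
  let w := zorich !₂[2 * p.1, 2 * p.2, 0]
  if w 2 = -1 then ∞ else ((c * (w 0 / (1 + w 2)), c * (w 1 / (1 + w 2))) : ℝ × ℝ)

/-- The centre of the square with index `q`: a zero of the map if `q.1 + q.2` is even, a pole if
it is odd. -/
def center (q : ℤ × ℤ) : ℝ × ℝ := (q.1 * (π / 2), q.2 * (π / 2))

/-- The composition of reflections in the coordinate axes with parities `q`. -/
def flip (q : ℤ × ℤ) (w : ℝ × ℝ) : ℝ × ℝ := ((-1) ^ q.1 * w.1, (-1) ^ q.2 * w.2)

theorem flip_flip (q : ℤ × ℤ) (w : ℝ × ℝ) : flip q (flip q w) = w := by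
  have h : ∀ (k : ℤ) (x : ℝ), (-1) ^ k * ((-1) ^ k * x) = x := by
    intro k x
    rcases neg_one_zpow_cases k with hk | hk <;> simp [hk]
  simp [flip, h]

theorem norm_flip (q : ℤ × ℤ) (w : ℝ × ℝ) : ‖flip q w‖ = ‖w‖ := by
  simp only [norm_eq_max, flip, abs_neg_one_zpow_mul]

theorem flip_sub (q : ℤ × ℤ) (v w : ℝ × ℝ) : flip q v - flip q w = flip q (v - w) := by
  ext <;> simp [flip, mul_sub]

theorem flip_zero (q : ℤ × ℤ) : flip q 0 = 0 := by ext <;> simp [flip]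

theorem continuous_flip (q : ℤ × ℤ) : Continuous (flip q) := by unfold flip; fun_prop

/-- The closed squares on which the planar map is given by a single formula. -/
def square (q : ℤ × ℤ) : Set (ℝ × ℝ) := Metric.closedBall (center q) (π / 4)

/-- Reflected local coordinates centred at `center q`. -/
def loc (q : ℤ × ℤ) (p : ℝ × ℝ) : ℝ × ℝ := flip q (p - center q)

theorem norm_loc (q : ℤ × ℤ) (p : ℝ × ℝ) : ‖loc q p‖ = dist p (center q) := by
  rw [loc, norm_flip, dist_eq_norm]

theorem mem_square_iff {q : ℤ × ℤ} {p : ℝ × ℝ} : p ∈ square q ↔ ‖loc q p‖ ≤ π / 4 := by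
  rw [norm_loc, square, Metric.mem_closedBall]

theorem loc_center_add_flip (q : ℤ × ℤ) (w : ℝ × ℝ) : loc q (center q + flip q w) = w := by
  rw [loc, add_sub_cancel_left, flip_flip]

theorem center_add_flip_loc (q : ℤ × ℤ) (p : ℝ × ℝ) : center q + flip q (loc q p) = p := by
  rw [loc, flip_flip, add_sub_cancel]

theorem loc_eq_zero_iff {q : ℤ × ℤ} {p : ℝ × ℝ} : loc q p = 0 ↔ p = center q := by
  rw [← norm_eq_zero, norm_loc, dist_eq_zero]

theorem exists_mem_square (p : ℝ × ℝ) : ∃ q, p ∈ square q := by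
  refine ⟨(foldIndex (2 * p.1), foldIndex (2 * p.2)), ?_⟩
  rw [mem_square_iff, norm_loc, dist_eq_norm, norm_eq_max]
  have h1 := abs_sub_foldIndex_mul_pi_le (2 * p.1)
  have h2 := abs_sub_foldIndex_mul_pi_le (2 * p.2)
  simp only [center, Prod.fst_sub, Prod.snd_sub]
  rw [abs_le] at h1 h2
  exact max_le (abs_le.2 ⟨by linarith, by linarith⟩) (abs_le.2 ⟨by linarith, by linarith⟩)

theorem zorich_plane_two (p : ℝ × ℝ) : zorich !₂[2 * p.1, 2 * p.2, 0] 2 =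
    (|cos (2 * p.1) + cos (2 * p.2)| - |cos (2 * p.1) - cos (2 * p.2)|) / 2 := by
  rw [← neg_one_zpow_mul_cos_max (abs_sub_foldIndex_mul_pi_le _) (abs_sub_foldIndex_mul_pi_le _)]
  simp [zorich, h, M, fold]

theorem zorich_plane_zero (p : ℝ × ℝ) : zorich !₂[2 * p.1, 2 * p.2, 0] 0 =
    h (arcsin (sin (2 * p.1))) (arcsin (sin (2 * p.2))) 0 := by
  simp [zorich, fold_eq_arcsin_sin]

theorem zorich_plane_one (p : ℝ × ℝ) : zorich !₂[2 * p.1, 2 * p.2, 0] 1 =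
    h (arcsin (sin (2 * p.1))) (arcsin (sin (2 * p.2))) 1 := by
  simp [zorich, fold_eq_arcsin_sin]

/-- The Zorich map on the square `square q` of the plane `z = 0`, in local coordinates. -/
theorem zorich_square {q : ℤ × ℤ} {p : ℝ × ℝ} (hp : p ∈ square q) :
    zorich !₂[2 * p.1, 2 * p.2, 0] 0 = (loc q p).1 * sin (2 * ‖loc q p‖) / eucl (loc q p) ∧
    zorich !₂[2 * p.1, 2 * p.2, 0] 1 = (loc q p).2 * sin (2 * ‖loc q p‖) / eucl (loc q p) ∧
    zorich !₂[2 * p.1, 2 * p.2, 0] 2 = (-1) ^ (q.1 + q.2) * cos (2 * ‖loc q p‖) := by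
  have hn := mem_square_iff.1 hp
  rw [norm_loc, dist_eq_norm, norm_eq_max] at hn
  have h1 : |2 * p.1 - q.1 * π| = 2 * |(p - center q).1| := by
    rw [show 2 * p.1 - q.1 * π = 2 * (p - center q).1 by simp [center]; ring, abs_mul,
      abs_of_pos two_pos]
  have h2 : |2 * p.2 - q.2 * π| = 2 * |(p - center q).2| := by
    rw [show 2 * p.2 - q.2 * π = 2 * (p - center q).2 by simp [center]; ring, abs_mul,
      abs_of_pos two_pos]
  have h1' : |2 * p.1 - q.1 * π| ≤ π / 2 := by
    rw [h1]; linarith [le_max_left |(p - center q).1| |(p - center q).2|]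
  have h2' : |2 * p.2 - q.2 * π| ≤ π / 2 := by
    rw [h2]; linarith [le_max_right |(p - center q).1| |(p - center q).2|]
  have hmax : max |2 * p.1 - q.1 * π| |2 * p.2 - q.2 * π| = 2 * ‖loc q p‖ := by
    rw [h1, h2, norm_loc, dist_eq_norm, norm_eq_max, mul_max_of_nonneg _ _ two_pos.le]
  have hf1 : fold (2 * p.1) = 2 * (loc q p).1 := by
    rw [fold_eq h1']; simp [loc, flip, center]; ring
  have hf2 : fold (2 * p.2) = 2 * (loc q p).2 := by
    rw [fold_eq h2']; simp [loc, flip, center]; ring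
  have hM : M (2 * (loc q p).1) (2 * (loc q p).2) = 2 * ‖loc q p‖ := by
    rw [M, abs_mul, abs_mul, abs_of_pos two_pos, ← mul_max_of_nonneg _ _ two_pos.le, norm_eq_max]
  have he : √((2 * (loc q p).1) ^ 2 + (2 * (loc q p).2) ^ 2) = 2 * eucl (loc q p) :=
    eucl_smul two_pos.le (loc q p)
  refine ⟨?_, ?_, ?_⟩
  · rw [zorich_plane_zero, ← fold_eq_arcsin_sin, ← fold_eq_arcsin_sin, hf1, hf2]
    simp only [h, hM, he]
    simp only [Matrix.cons_val]
    rw [mul_assoc, mul_div_mul_left _ _ two_ne_zero]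
  · rw [zorich_plane_one, ← fold_eq_arcsin_sin, ← fold_eq_arcsin_sin, hf1, hf2]
    simp only [h, hM, he]
    simp only [Matrix.cons_val]
    rw [mul_assoc, mul_div_mul_left _ _ two_ne_zero]
  · rw [zorich_plane_two, ← neg_one_zpow_mul_cos_max h1' h2', hmax]

/-- Half-angle formula: `sin 2t / (1 + cos 2t) = tan t`. -/
theorem planarT_square_even {c : ℝ} {q : ℤ × ℤ} (hq : Even (q.1 + q.2)) {p : ℝ × ℝ}
    (hp : p ∈ square q) :
    planarT c p = ((c * tan ‖loc q p‖ / eucl (loc q p)) • loc q p : ℝ × ℝ) := by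
  obtain ⟨h0, h1, h2⟩ := zorich_square hp
  have hn := mem_square_iff.1 hp
  have hn0 := norm_nonneg (loc q p)
  have hpi := pi_pos
  have hc : 0 < cos ‖loc q p‖ := cos_pos_of_mem_Ioo ⟨by linarith, by linarith⟩
  rw [hq.neg_one_zpow, one_mul, cos_two_mul] at h2
  rw [sin_two_mul] at h0 h1
  simp only [planarT, h0, h1, h2]
  rw [if_neg (by nlinarith)]
  congr 1
  have hfac : ∀ x : ℝ, c * (x * (2 * sin ‖loc q p‖ * cos ‖loc q p‖) / eucl (loc q p) /
      (1 + (2 * cos ‖loc q p‖ ^ 2 - 1))) = c * tan ‖loc q p‖ / eucl (loc q p) * x := by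
    intro x
    rw [tan_eq_sin_div_cos, show 1 + (2 * cos ‖loc q p‖ ^ 2 - 1) = 2 * cos ‖loc q p‖ ^ 2 by ring]
    field_simp
  exact Prod.ext (hfac _) (hfac _)

theorem planarT_center_odd {c : ℝ} {q : ℤ × ℤ} (hq : ¬ Even (q.1 + q.2)) :
    planarT c (center q) = ∞ := by
  have hp : center q ∈ square q := Metric.mem_closedBall_self (by positivity)
  obtain ⟨-, -, h2⟩ := zorich_square hp
  rw [(Int.not_even_iff_odd.1 hq).neg_one_zpow, loc_eq_zero_iff.2 rfl] at h2
  simp only [planarT]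
  rw [if_pos (by simp [h2])]

/-- The reflected sign turns the quotient into `sin 2t / (1 - cos 2t) = cot t`. -/
theorem planarT_square_odd {c : ℝ} {q : ℤ × ℤ} (hq : ¬ Even (q.1 + q.2)) {p : ℝ × ℝ}
    (hp : p ∈ square q) (hpc : p ≠ center q) :
    planarT c p = ((c / tan ‖loc q p‖ / eucl (loc q p)) • loc q p : ℝ × ℝ) := by
  obtain ⟨h0, h1, h2⟩ := zorich_square hp
  have hn := mem_square_iff.1 hp
  have hn0 : 0 < ‖loc q p‖ := norm_pos_iff.2 fun h => hpc (loc_eq_zero_iff.1 h)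
  have hpi := pi_pos
  have hc : 0 < cos ‖loc q p‖ := cos_pos_of_mem_Ioo ⟨by linarith, by linarith⟩
  have hs : 0 < sin ‖loc q p‖ := sin_pos_of_pos_of_lt_pi hn0 (by linarith)
  have hsc := sin_sq_add_cos_sq ‖loc q p‖
  have h2' : 1 + zorich !₂[2 * p.1, 2 * p.2, 0] 2 = 2 * sin ‖loc q p‖ ^ 2 := by
    rw [h2, (Int.not_even_iff_odd.1 hq).neg_one_zpow, cos_two_mul]
    linarith
  rw [sin_two_mul] at h0 h1
  simp only [planarT, h0, h1, h2']
  rw [if_neg (by nlinarith)]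
  congr 1
  have hfac : ∀ x : ℝ, c * (x * (2 * sin ‖loc q p‖ * cos ‖loc q p‖) / eucl (loc q p) /
      (2 * sin ‖loc q p‖ ^ 2)) = c / tan ‖loc q p‖ / eucl (loc q p) * x := by
    intro x
    rw [tan_eq_sin_div_cos]
    field_simp
  exact Prod.ext (hfac _) (hfac _)

/-! ### Inverse branches of the planar map -/

/-- The angular profile of the inverse branch with index `q`. -/
def angle (c : ℝ) (q : ℤ × ℤ) (y : ℝ × ℝ) : ℝ :=
  if Even (q.1 + q.2) then arctan (eucl y / c) else arctan (c / eucl y)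

/-- The inverse branch of the planar map with values in `square q`. -/
def branch (c : ℝ) (q : ℤ × ℤ) (y : ℝ × ℝ) : ℝ × ℝ :=
  -- At `y = 0` the convention `a / 0 = 0` gives the centre, the correct value for even squares; `0`
  -- is outside the domain for odd ones when `c > 0`.
  center q + flip q ((angle c q y / ‖y‖) • y)

/-- The domain of the inverse branch: a closed disk or the complement of an open disk. -/
def branchDomain (c : ℝ) (q : ℤ × ℤ) : Set (ℝ × ℝ) :=
  if Even (q.1 + q.2) then {y | eucl y ≤ c} else {y | c ≤ eucl y}

variable {c : ℝ} {q : ℤ × ℤ} {p x y : ℝ × ℝ}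

theorem eucl_zero : eucl 0 = 0 := by simp [eucl]

theorem eucl_pos_iff_ne_zero : 0 < eucl y ↔ y ≠ 0 :=
  ⟨fun h h0 => by simp [h0, eucl_zero] at h, eucl_pos⟩

theorem div_mul_norm_le {a : ℝ} (ha : 0 ≤ a) (y : ℝ × ℝ) : a / ‖y‖ * ‖y‖ ≤ a := by
  rcases eq_or_ne ‖y‖ 0 with h | h
  · simpa [h] using ha
  · rw [div_mul_cancel₀ _ h]

theorem abs_arctan_sub_le (a b : ℝ) : |arctan a - arctan b| ≤ |a - b| := by
  have := Convex.norm_image_sub_le_of_norm_deriv_le (f := arctan) (C := 1) (s := Set.univ)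
    (fun x _ => differentiable_arctan x) (fun x _ => by
      rw [Real.deriv_arctan, Real.norm_of_nonneg (by positivity), div_le_one (by positivity)]
      nlinarith [sq_nonneg x]) convex_univ (Set.mem_univ b) (Set.mem_univ a)
  simpa using this

theorem arctan_le_self {a : ℝ} (ha : 0 ≤ a) : arctan a ≤ a := by
  have := abs_arctan_sub_le a 0
  rw [arctan_zero, sub_zero, sub_zero, abs_of_nonneg ha] at this
  exact (le_abs_self _).trans this

theorem angle_nonneg (hc : 0 < c) : 0 ≤ angle c q y := by
  unfold angle
  have := eucl_nonneg y
  split_ifs <;> exact arctan_nonneg.2 (by positivity)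

theorem angle_le (hc : 0 < c) (hy : y ∈ branchDomain c q) : angle c q y ≤ π / 4 := by
  unfold angle
  unfold branchDomain at hy
  rw [← arctan_one]
  split_ifs at hy ⊢
  · exact arctan_strictMono.monotone ((div_le_one hc).2 hy)
  · exact arctan_strictMono.monotone ((div_le_one (hc.trans_le hy)).2 hy)

theorem angle_lt (hc : 0 < c) (hy : y ∈ branchDomain c q) (hne : eucl y ≠ c) :
    angle c q y < π / 4 := by
  unfold angle
  unfold branchDomain at hy
  rw [← arctan_one]
  split_ifs at hy ⊢
  · exact arctan_strictMono ((div_lt_one hc).2 (lt_of_le_of_ne hy hne))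
  · exact arctan_strictMono ((div_lt_one (hc.trans_le hy)).2 (lt_of_le_of_ne hy hne.symm))

theorem norm_loc_branch_le (hc : 0 < c) : ‖loc q (branch c q y)‖ ≤ angle c q y := by
  rw [branch, loc_center_add_flip, norm_smul, norm_div, norm_norm,
    Real.norm_of_nonneg (angle_nonneg hc)]
  exact div_mul_norm_le (angle_nonneg hc) _

theorem branch_mem (hc : 0 < c) (hy : y ∈ branchDomain c q) : branch c q y ∈ square q :=
  mem_square_iff.2 ((norm_loc_branch_le hc).trans (angle_le hc hy))

theorem planarT_branch (hc : 0 < c) (hy : y ∈ branchDomain c q) :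
    planarT c (branch c q y) = y := by
  have hmem := branch_mem hc hy
  by_cases hq : Even (q.1 + q.2)
  · rw [planarT_square_even hq hmem]
    rw [branch, loc_center_add_flip]
    congr 1
    rcases eq_or_ne y 0 with rfl | hy0
    · simp
    have hn : 0 < ‖y‖ := norm_pos_iff.2 hy0
    have he := eucl_pos hy0
    have ha : angle c q y = arctan (eucl y / c) := if_pos hq
    have ha0 : 0 < angle c q y := by rw [ha]; exact arctan_pos.2 (by positivity)
    rw [norm_smul, norm_div, norm_norm, Real.norm_of_nonneg ha0.le, div_mul_cancel₀ _ hn.ne',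
      eucl_smul (by positivity), smul_smul]
    rw [show c * tan (angle c q y) = eucl y by rw [ha, tan_arctan]; field_simp]
    rw [show eucl y / (angle c q y / ‖y‖ * eucl y) * (angle c q y / ‖y‖) = 1 by field_simp,
      one_smul]
  · have hdom : c ≤ eucl y := by simpa [branchDomain, hq] using hy
    have he := hc.trans_le hdom
    have hy0 : y ≠ 0 := eucl_pos_iff_ne_zero.1 he
    have hn : 0 < ‖y‖ := norm_pos_iff.2 hy0
    have ha : angle c q y = arctan (c / eucl y) := if_neg hq
    have ha0 : 0 < angle c q y := by rw [ha]; exact arctan_pos.2 (by positivity)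
    have hne : branch c q y ≠ center q := by
      intro h
      rw [← loc_eq_zero_iff, branch, loc_center_add_flip] at h
      exact smul_ne_zero (by positivity) hy0 h
    rw [planarT_square_odd hq hmem hne]
    rw [branch, loc_center_add_flip]
    congr 1
    rw [norm_smul, norm_div, norm_norm, Real.norm_of_nonneg ha0.le, div_mul_cancel₀ _ hn.ne',
      eucl_smul (by positivity), smul_smul]
    rw [show c / tan (angle c q y) = eucl y by rw [ha, tan_arctan]; field_simp]
    rw [show eucl y / (angle c q y / ‖y‖ * eucl y) * (angle c q y / ‖y‖) = 1 by field_simp,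
      one_smul]

theorem planarT_eq_infty_iff (hp : p ∈ square q) :
    planarT c p = ∞ ↔ ¬ Even (q.1 + q.2) ∧ p = center q := by
  constructor
  · intro h
    by_cases hq : Even (q.1 + q.2)
    · rw [planarT_square_even hq hp] at h
      exact absurd h (OnePoint.coe_ne_infty _)
    · refine ⟨hq, by_contra fun hne => ?_⟩
      rw [planarT_square_odd hq hp hne] at h
      exact absurd h (OnePoint.coe_ne_infty _)
  · rintro ⟨hq, rfl⟩
    exact planarT_center_odd hq

/-- On a square the local sup norm is at most `π/4`, so its tangent is at most `1` and `arctan`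
recovers it; the direction is unchanged by the radial map. -/
theorem branch_of_planarT_eq (hc : 0 < c) (hp : p ∈ square q) (h : planarT c p = y) :
    y ∈ branchDomain c q ∧ branch c q y = p := by
  have hn := mem_square_iff.1 hp
  have hn0 := norm_nonneg (loc q p)
  have hpi := pi_pos
  have htan1 : tan ‖loc q p‖ ≤ 1 := by
    rw [← tan_pi_div_four]
    exact strictMonoOn_tan.monotoneOn ⟨by linarith, by linarith⟩ ⟨by linarith, by linarith⟩ hn
  have harctan : arctan (tan ‖loc q p‖) = ‖loc q p‖ := arctan_tan (by linarith) (by linarith)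
  by_cases hq : Even (q.1 + q.2)
  · rw [planarT_square_even hq hp, OnePoint.coe_eq_coe] at h
    rcases eq_or_ne (loc q p) 0 with h0 | h0
    · have hy : y = 0 := by rw [← h, h0, smul_zero]
      subst hy
      refine ⟨by simpa [branchDomain, hq, eucl_zero] using hc.le, ?_⟩
      rw [branch, smul_zero, flip_zero, add_zero, loc_eq_zero_iff.1 h0]
    · have hpos := norm_pos_iff.2 h0
      have he := eucl_pos h0
      have htan : 0 < tan ‖loc q p‖ := tan_pos_of_pos_of_lt_pi_div_two hpos (by linarith)
      have hey : eucl y = c * tan ‖loc q p‖ := by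
        rw [← h, eucl_smul (by positivity)]; field_simp
      refine ⟨by simp only [branchDomain, if_pos hq, Set.mem_ofPred_eq, hey]; nlinarith, ?_⟩
      have ha : angle c q y = ‖loc q p‖ := by
        rw [angle, if_pos hq, hey, mul_div_cancel_left₀ _ hc.ne', harctan]
      rw [branch, ha, ← h, norm_smul, Real.norm_of_nonneg (by positivity), smul_smul]
      rw [show ‖loc q p‖ / (c * tan ‖loc q p‖ / eucl (loc q p) * ‖loc q p‖) *
        (c * tan ‖loc q p‖ / eucl (loc q p)) = 1 by field_simp, one_smul, center_add_flip_loc]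
  · have h0 : loc q p ≠ 0 := by
      intro h0
      rw [(planarT_eq_infty_iff hp).2 ⟨hq, loc_eq_zero_iff.1 h0⟩] at h
      exact OnePoint.infty_ne_coe y h
    rw [planarT_square_odd hq hp (fun hpc => h0 (loc_eq_zero_iff.2 hpc)),
      OnePoint.coe_eq_coe] at h
    have hpos := norm_pos_iff.2 h0
    have he := eucl_pos h0
    have htan : 0 < tan ‖loc q p‖ := tan_pos_of_pos_of_lt_pi_div_two hpos (by linarith)
    have hey : eucl y = c / tan ‖loc q p‖ := by
      rw [← h, eucl_smul (by positivity)]; field_simp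
    refine ⟨?_, ?_⟩
    · simp only [branchDomain, if_neg hq, Set.mem_ofPred_eq, hey]
      rw [le_div_iff₀ htan]
      nlinarith
    · have ha : angle c q y = ‖loc q p‖ := by
        rw [angle, if_neg hq, hey, div_div_cancel₀ hc.ne', harctan]
      rw [branch, ha, ← h, norm_smul, Real.norm_of_nonneg (by positivity), smul_smul]
      rw [show ‖loc q p‖ / (c / tan ‖loc q p‖ / eucl (loc q p) * ‖loc q p‖) *
        (c / tan ‖loc q p‖ / eucl (loc q p)) = 1 by field_simp, one_smul, center_add_flip_loc]

/-- Only the boundary of a square is sent to the circle `eucl y = c`. Off that circle, open and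
closed squares impose the same condition, which later makes cylinders clopen. -/
theorem mem_ball_of_eucl_ne (hc : 0 < c) (hp : p ∈ square q) (h : planarT c p = y)
    (hy : eucl y ≠ c) : p ∈ Metric.ball (center q) (π / 4) := by
  obtain ⟨hdom, rfl⟩ := branch_of_planarT_eq hc hp h
  rw [Metric.mem_ball, ← norm_loc]
  exact (norm_loc_branch_le hc).trans_lt (angle_lt hc hdom hy)

theorem exists_int_adjacent {x : ℝ} {k : ℤ} (hx : |x - k * (π / 2)| = π / 4) :
    ∃ k' : ℤ, (k' = k + 1 ∨ k' = k - 1) ∧ |x - k' * (π / 2)| ≤ π / 4 := by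
  have hpi := pi_pos
  rcases abs_choice (x - k * (π / 2)) with h | h
  · refine ⟨k + 1, Or.inl rfl, ?_⟩
    push_cast
    rw [abs_le]; constructor <;> linarith
  · refine ⟨k - 1, Or.inr rfl, ?_⟩
    push_cast
    rw [abs_le]; constructor <;> linarith

/-- Points with `|T_c p| = c` lie on the common boundary of two squares of opposite parity. -/
theorem exists_adjacent_square (hc : 0 < c) (hp : p ∈ square q) (h : planarT c p = y)
    (hy : eucl y = c) : ∃ q' : ℤ × ℤ, (Even (q'.1 + q'.2) ↔ ¬ Even (q.1 + q.2)) ∧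
      p ∈ square q' := by
  obtain ⟨-, hb⟩ := branch_of_planarT_eq hc hp h
  have hy0 : y ≠ 0 := eucl_pos_iff_ne_zero.1 (hy ▸ hc)
  have ha : angle c q y = π / 4 := by
    rw [angle, hy, div_self hc.ne', arctan_one, ite_self]
  have hn : ‖p - center q‖ = π / 4 := by
    rw [← norm_flip q, ← loc, ← hb, branch, loc_center_add_flip, ha, norm_smul, norm_div,
      norm_norm, Real.norm_of_nonneg (by positivity), div_mul_cancel₀ _ (norm_ne_zero_iff.2 hy0)]
  rw [norm_eq_max] at hn
  have h1 : |p.1 - q.1 * (π / 2)| ≤ π / 4 := hn ▸ le_max_left _ _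
  have h2 : |p.2 - q.2 * (π / 2)| ≤ π / 4 := hn ▸ le_max_right _ _
  rcases max_choice |(p - center q).1| |(p - center q).2| with hm | hm <;> rw [hm] at hn
  · obtain ⟨k, hk, hk'⟩ := exists_int_adjacent hn
    refine ⟨(k, q.2), ?_, ?_⟩
    · rcases hk with rfl | rfl <;> simp only [Int.even_add, Int.even_sub, Int.not_even_one] <;>
        tauto
    · rw [square, Metric.mem_closedBall, dist_eq_norm, norm_eq_max]
      exact max_le hk' h2
  · obtain ⟨k, hk, hk'⟩ := exists_int_adjacent hn
    refine ⟨(q.1, k), ?_, ?_⟩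
    · rcases hk with rfl | rfl <;> simp only [Int.even_add, Int.even_sub, Int.not_even_one] <;>
        tauto
    · rw [square, Metric.mem_closedBall, dist_eq_norm, norm_eq_max]
      exact max_le h1 hk'

theorem dist_branch_center_le (hc : 0 < c) (hq : ¬ Even (q.1 + q.2)) :
    dist (branch c q y) (center q) ≤ c / eucl y := by
  rw [← norm_loc]
  refine (norm_loc_branch_le hc).trans ?_
  rw [angle, if_neg hq]
  have h0 : 0 ≤ c / eucl y := div_nonneg hc.le (eucl_nonneg y)
  exact arctan_le_self h0

theorem continuousOn_branch (hc : 0 < c) : ContinuousOn (branch c q) (branchDomain c q) := by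
  have hrad : ContinuousOn (fun y : ℝ × ℝ => (angle c q y / ‖y‖) • y) (branchDomain c q) := by
    intro y hy
    rcases eq_or_ne y 0 with rfl | hy0
    · have hq : Even (q.1 + q.2) := by
        by_contra hq
        have : c ≤ eucl 0 := by simpa [branchDomain, hq] using hy
        rw [eucl_zero] at this
        linarith
      refine ContinuousAt.continuousWithinAt ?_
      rw [ContinuousAt, smul_zero]
      refine squeeze_zero_norm (a := fun y => angle c q y) (fun z => ?_) ?_
      · rw [norm_smul, norm_div, norm_norm, Real.norm_of_nonneg (angle_nonneg hc)]
        exact div_mul_norm_le (angle_nonneg hc) _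
      · have : Continuous (angle c q) := by
          have : angle c q = fun y => arctan (eucl y / c) := funext fun y => if_pos hq
          rw [this]
          exact continuous_arctan.comp (continuous_eucl.div_const c)
        have h0 : angle c q 0 = 0 := by simp [angle, hq, eucl_zero]
        simpa [h0] using this.tendsto 0
    · refine ContinuousAt.continuousWithinAt ?_
      have ha : ContinuousAt (angle c q) y := by
        by_cases hq : Even (q.1 + q.2)
        · have : angle c q = fun y => arctan (eucl y / c) := funext fun y => if_pos hq
          rw [this]
          exact (continuous_arctan.comp (continuous_eucl.div_const c)).continuousAt
        · have : angle c q = fun y => arctan (c / eucl y) := funext fun y => if_neg hq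
          rw [this]
          exact continuous_arctan.continuousAt.comp
            (continuousAt_const.div continuous_eucl.continuousAt (eucl_pos hy0).ne')
      exact (ha.div continuous_norm.continuousAt (norm_ne_zero_iff.2 hy0)).smul continuousAt_id
  exact ((continuous_flip q).comp_continuousOn hrad).const_add (center q)

/-- Inverse branches at poles are contractions near infinity. -/
theorem dist_branch_le (hc : 0 < c) {R : ℝ} (hR : 0 < R) (hRc : 12 * c ≤ R ^ 2)
    (hq : ¬ Even (q.1 + q.2)) {z : ℝ × ℝ} (hy : R ≤ eucl y) (hz : R ≤ eucl z) :
    dist (branch c q y) (branch c q z) ≤ 1 / 2 * dist y z := by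
  have hey := hR.trans_le hy
  have hez := hR.trans_le hz
  have hny : 0 < ‖y‖ := norm_pos_iff.2 (eucl_pos_iff_ne_zero.1 hey)
  have hnz : 0 < ‖z‖ := norm_pos_iff.2 (eucl_pos_iff_ne_zero.1 hez)
  have hnz' : R ≤ 2 * ‖z‖ := hz.trans (eucl_le z)
  have h1 : |c / eucl y - c / eucl z| ≤ 2 * c / R ^ 2 * ‖y - z‖ := by
    rw [div_sub_div _ _ hey.ne' hez.ne', ← mul_comm (eucl z) c, ← mul_comm c, ← mul_comm c (eucl y),
      ← mul_sub, abs_div, abs_mul, abs_of_pos hc, abs_of_pos (by positivity : 0 < eucl y * eucl z)]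
    have h2 : |eucl z - eucl y| ≤ 2 * ‖y - z‖ := by
      rw [norm_sub_rev]; exact abs_eucl_sub_le z y
    have h3 : R ^ 2 ≤ eucl y * eucl z := by nlinarith
    calc c * |eucl z - eucl y| / (eucl y * eucl z) ≤ c * (2 * ‖y - z‖) / R ^ 2 := by gcongr
      _ = 2 * c / R ^ 2 * ‖y - z‖ := by ring
  have hA : arctan (c / eucl y) ≤ c / R :=
    (arctan_le_self (by positivity)).trans (by gcongr)
  have hA0 : 0 ≤ arctan (c / eucl y) := arctan_nonneg.2 (by positivity)
  have hinv : 1 / ‖z‖ ≤ 2 / R := by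
    rw [div_le_div_iff₀ hnz hR]; linarith
  have hdir : ‖(1 / ‖y‖) • y - (1 / ‖z‖) • z‖ ≤ 4 / R * ‖y - z‖ := by
    have hsplit : (1 / ‖y‖) • y - (1 / ‖z‖) • z =
        (1 / ‖z‖) • (y - z) + ((1 / ‖y‖ - 1 / ‖z‖)) • y := by
      rw [sub_smul, smul_sub]; abel
    have hb1 : ‖(1 / ‖z‖) • (y - z)‖ ≤ 2 / R * ‖y - z‖ := by
      rw [norm_smul, Real.norm_of_nonneg (by positivity)]
      exact mul_le_mul_of_nonneg_right hinv (norm_nonneg _)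
    have hb2 : ‖(1 / ‖y‖ - 1 / ‖z‖) • y‖ ≤ 2 / R * ‖y - z‖ := by
      rw [norm_smul, div_sub_div _ _ hny.ne' hnz.ne', one_mul, mul_one, norm_div, norm_mul,
        norm_norm, norm_norm, Real.norm_eq_abs]
      rw [show |‖z‖ - ‖y‖| / (‖y‖ * ‖z‖) * ‖y‖ = 1 / ‖z‖ * |‖z‖ - ‖y‖| by field_simp]
      have := abs_norm_sub_norm_le z y
      rw [norm_sub_rev] at this
      exact mul_le_mul hinv this (abs_nonneg _) (by positivity)
    rw [hsplit]
    refine (norm_add_le _ _).trans ((add_le_add hb1 hb2).trans_eq (by ring))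
  have hangle : ∀ w, angle c q w = arctan (c / eucl w) := fun w => if_neg hq
  have hsplit : (angle c q y / ‖y‖) • y - (angle c q z / ‖z‖) • z =
      arctan (c / eucl y) • ((1 / ‖y‖) • y - (1 / ‖z‖) • z) +
        (arctan (c / eucl y) - arctan (c / eucl z)) • ((1 / ‖z‖) • z) := by
    rw [hangle, hangle, smul_sub, sub_smul, smul_smul, smul_smul, smul_smul]
    simp only [mul_one_div]
    abel
  have hunit : ‖(1 / ‖z‖) • z‖ = 1 := by
    rw [norm_smul, Real.norm_of_nonneg (by positivity)]; field_simp
  -- The change of direction contributes `4c/R²` and the change of angle `2c/R²`; their sum is at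
  -- most `1/2` exactly when `12c ≤ R²`.
  have hfin : c / R * (4 / R * ‖y - z‖) + 2 * c / R ^ 2 * ‖y - z‖ * 1 ≤ 1 / 2 * ‖y - z‖ := by
    have : 6 * c / R ^ 2 ≤ 1 / 2 := by rw [div_le_iff₀ (by positivity)]; linarith
    calc _ = 6 * c / R ^ 2 * ‖y - z‖ := by field_simp; ring
      _ ≤ _ := by gcongr
  rw [dist_eq_norm, dist_eq_norm, branch, branch, add_sub_add_left_eq_sub, flip_sub, norm_flip,
    hsplit]
  refine (norm_add_le _ _).trans (le_trans ?_ hfin)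
  rw [norm_smul, norm_smul, hunit, Real.norm_of_nonneg hA0, Real.norm_eq_abs]
  gcongr
  exact (abs_arctan_sub_le _ _).trans h1

/-! ### Continuity, openness and pulling back closures -/

/-- The planar map is continuous away from its poles. -/
theorem continuousAt_planarT (hp : planarT c p ≠ ∞) :
    ∃ g : ℝ × ℝ → ℝ × ℝ, ContinuousAt g p ∧ ∀ᶠ p' in 𝓝 p, planarT c p' = g p' := by
  -- The coordinates of `W` have formulas free of `round`, through `arcsin ∘ sin` and absolute
  -- values of cosines, so nothing has to be glued across squares.
  let W : ℝ × ℝ → E3 := fun p => zorich !₂[2 * p.1, 2 * p.2, 0]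
  have hh : ∀ i : ℝ × ℝ → ℝ, Continuous i → (∀ y, |i y| ≤ ‖y‖) →
      Continuous fun y : ℝ × ℝ => i y * sin ‖y‖ / eucl y := by
    intro i hi hle
    rw [continuous_iff_continuousAt]
    intro y
    rcases eq_or_ne y 0 with rfl | hy
    · rw [ContinuousAt, eucl_zero, div_zero]
      refine squeeze_zero_norm (a := fun y => ‖y‖) (fun y => ?_)
        tendsto_norm_zero
      have h1 : |sin (‖y‖)| ≤ ‖y‖ :=
        abs_sin_le_abs.trans_eq (abs_of_nonneg (norm_nonneg y))
      have h2 : |i y| ≤ eucl y := (hle y).trans (norm_le_eucl y)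
      rw [norm_div, norm_mul, Real.norm_eq_abs, Real.norm_eq_abs, Real.norm_eq_abs,
        abs_of_nonneg (eucl_nonneg y)]
      refine div_le_of_le_mul₀ (eucl_nonneg y) (norm_nonneg y) ?_
      rw [mul_comm ‖y‖]
      gcongr
      exact eucl_nonneg y
    · exact (hi.continuousAt.mul (continuous_sin.continuousAt.comp
        continuous_norm.continuousAt)).div continuous_eucl.continuousAt (eucl_pos hy).ne'
  have hF : Continuous fun p : ℝ × ℝ => (arcsin (sin (2 * p.1)), arcsin (sin (2 * p.2))) := by
    fun_prop
  have hW0 : Continuous fun p => W p 0 := by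
    have : (fun p => W p 0) = (fun y : ℝ × ℝ => y.1 * sin ‖y‖ / eucl y) ∘
        fun p : ℝ × ℝ => (arcsin (sin (2 * p.1)), arcsin (sin (2 * p.2))) := by
      funext p
      simp [W, zorich_plane_zero, h, M, norm_eq_max, eucl]
    rw [this]
    exact (hh Prod.fst continuous_fst fun y => le_max_left _ _).comp hF
  have hW1 : Continuous fun p => W p 1 := by
    have : (fun p => W p 1) = (fun y : ℝ × ℝ => y.2 * sin ‖y‖ / eucl y) ∘
        fun p : ℝ × ℝ => (arcsin (sin (2 * p.1)), arcsin (sin (2 * p.2))) := by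
      funext p
      simp [W, zorich_plane_one, h, M, norm_eq_max, eucl]
    rw [this]
    exact (hh Prod.snd continuous_snd fun y => le_max_right _ _).comp hF
  have hW2 : Continuous fun p => W p 2 := by
    simp only [W, zorich_plane_two]
    fun_prop
  have hne : W p 2 ≠ -1 := fun h => hp (if_pos h)
  have hne' : 1 + W p 2 ≠ 0 := fun h => hne (by linarith)
  refine ⟨fun p => (c * (W p 0 / (1 + W p 2)), c * (W p 1 / (1 + W p 2))), ?_, ?_⟩
  · have hden : ContinuousAt (fun p => 1 + W p 2) p := (continuous_const.add hW2).continuousAt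
    exact (continuousAt_const.mul (hW0.continuousAt.div hden hne')).prodMk
      (continuousAt_const.mul (hW1.continuousAt.div hden hne'))
  · filter_upwards [hW2.continuousAt.eventually_ne hne] with p' hp'
    exact if_neg hp'

theorem not_even_of_lt_eucl (hc : 0 < c) (hp : p ∈ square q) (h : planarT c p = y)
    (hy : c < eucl y) : ¬ Even (q.1 + q.2) := by
  intro hq
  have := (branch_of_planarT_eq hc hp h).1
  rw [branchDomain, if_pos hq] at this
  exact absurd hy (not_lt.2 this)

theorem mem_branchDomain_of_not_even (hq : ¬ Even (q.1 + q.2)) (hy : c ≤ eucl y) :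
    y ∈ branchDomain c q := by
  rw [branchDomain, if_neg hq]
  exact hy

/-- The planar map is open. -/
theorem eventually_exists_preimage (hc : 0 < c) (h : planarT c x = y) {U : Set (ℝ × ℝ)}
    (hU : U ∈ 𝓝 x) : ∀ᶠ y' : ℝ × ℝ in 𝓝 y, ∃ x' ∈ U, planarT c x' = y' := by
  have hpiece : ∀ q, x ∈ square q →
      ∀ᶠ y' in 𝓝 y, y' ∈ branchDomain c q → ∃ x' ∈ U, planarT c x' = y' := by
    intro q hq
    obtain ⟨hdom, hb⟩ := branch_of_planarT_eq hc hq h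
    have := continuousOn_branch hc y hdom
    rw [ContinuousWithinAt, hb] at this
    rw [← eventually_nhdsWithin_iff]
    filter_upwards [this hU, self_mem_nhdsWithin] with y' hy' hd
    exact ⟨_, hy', planarT_branch hc hd⟩
  obtain ⟨q, hq⟩ := exists_mem_square x
  -- On the critical circle a single branch covers only one side; the adjacent square of opposite
  -- parity covers the other.
  by_cases hy : eucl y = c
  · obtain ⟨q', hqq', hq'⟩ := exists_adjacent_square hc hq h hy
    filter_upwards [hpiece q hq, hpiece q' hq'] with y' h1 h2
    have hcover : y' ∈ branchDomain c q ∨ y' ∈ branchDomain c q' := by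
      by_cases he : Even (q.1 + q.2)
      · simp only [branchDomain, hqq', he, not_true, if_true, if_false]
        exact le_total (eucl y') c
      · simp only [branchDomain, hqq', he, not_false_eq_true, if_true, if_false]
        exact le_total c (eucl y')
    exact hcover.elim h1 h2
  · have hdom := (branch_of_planarT_eq hc hq h).1
    have : ∀ᶠ y' in 𝓝 y, y' ∈ branchDomain c q := by
      by_cases he : Even (q.1 + q.2)
      · rw [branchDomain, if_pos he] at hdom ⊢
        filter_upwards [continuous_eucl.continuousAt.eventually_lt_const
          (lt_of_le_of_ne hdom hy)] with y' hy' using hy'.le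
      · rw [branchDomain, if_neg he] at hdom ⊢
        filter_upwards [continuous_eucl.continuousAt.eventually_const_lt
          (lt_of_le_of_ne hdom (Ne.symm hy))] with y' hy' using hy'.le
    filter_upwards [hpiece q hq, this] with y' h1 h2 using h1 h2

theorem mem_closure_of_planarT (hc : 0 < c) {A : Set (ℝ × ℝ)}
    (hA : ∀ x y : ℝ × ℝ, planarT c x = y → y ∈ A → x ∈ A) (h : planarT c x = y)
    (hy : y ∈ closure A) : x ∈ closure A := by
  rw [mem_closure_iff_nhds]
  intro U hU
  obtain ⟨y', hy'A, x', hx'U, hx'⟩ :=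
    ((mem_closure_iff_frequently.1 hy).and_eventually (eventually_exists_preimage hc h hU)).exists
  exact ⟨x', hx'U, hA x' y' hx' hy'A⟩

theorem mem_closure_of_pole (hc : 0 < c) {A : Set (ℝ × ℝ)}
    (hA : ∀ x y : ℝ × ℝ, planarT c x = y → y ∈ A → x ∈ A)
    (hunb : ∀ r, ∃ y ∈ A, r ≤ eucl y) (h : planarT c x = ∞) : x ∈ closure A := by
  obtain ⟨q, hq⟩ := exists_mem_square x
  obtain ⟨hodd, rfl⟩ := (planarT_eq_infty_iff hq).1 h
  rw [Metric.mem_closure_iff]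
  intro ε hε
  -- The bound `c` puts `y` in the domain of the branch; the bound `c / ε + 1` brings its image
  -- within `ε` of the pole.
  obtain ⟨y, hy, hr⟩ := hunb (max c (c / ε + 1))
  have hcy : c ≤ eucl y := (le_max_left _ _).trans hr
  have hey : c / ε < eucl y := by linarith [(le_max_right c (c / ε + 1)).trans hr]
  refine ⟨branch c q y, hA _ y (planarT_branch hc (mem_branchDomain_of_not_even hodd hcy)) hy, ?_⟩
  rw [dist_comm]
  refine (dist_branch_center_le hc hodd).trans_lt ?_
  rw [div_lt_iff₀ (hc.trans_le hcy)]
  rwa [div_lt_iff₀ hε, mul_comm] at hey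

theorem eventually_le_eucl {u : ℕ → ℝ × ℝ} (hu : Tendsto u atTop (cocompact (ℝ × ℝ))) (R : ℝ) :
    ∃ N, ∀ k ≥ N, R ≤ eucl (u k) := by
  have := (tendsto_norm_cocompact_atTop.comp hu).eventually_ge_atTop R
  obtain ⟨N, hN⟩ := eventually_atTop.1 this
  exact ⟨N, fun k hk => (hN k hk).trans (norm_le_eucl _)⟩

theorem escapingSet_subset_closure (hc : 0 < c) :
    escapingSet (planarT c) ⊆ closure (backwardOrbitInfty (planarT c)) := by
  intro x hx
  obtain ⟨u, rfl, hu, hlim⟩ := mem_escapingSet_iff.1 hx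
  -- A point within sup distance `1` loses at most `2` in Euclidean norm, leaving `R = c + 12`, for
  -- which `12c ≤ R²`.
  obtain ⟨N, hN⟩ := eventually_le_eucl hlim (c + 14)
  choose q hq using fun k => exists_mem_square (u k)
  have hodd : ∀ k ≥ N, ¬ Even ((q k).1 + (q k).2) := fun k hk =>
    not_even_of_lt_eucl hc (hq k) (hu k) (by linarith [hN (k + 1) (by omega)])
  -- The pole in the square of `u (k + m)` is pulled back `m` times along the branches of the orbit,
  -- halving the error each time.
  have happrox : ∀ m : ℕ, ∀ k ≥ N, ∃ z ∈ backwardOrbitInfty (planarT c),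
      dist z (u k) ≤ (1 / 2) ^ m := by
    intro m
    induction m with
    | zero =>
      intro k hk
      refine ⟨center (q k), backwardOrbitInfty_of_pole (planarT_center_odd (hodd k hk)), ?_⟩
      rw [dist_comm, pow_zero]
      exact (Metric.mem_closedBall.1 (hq k)).trans (by linarith [pi_le_four])
    | succ m ih =>
      intro k hk
      obtain ⟨z, hz, hd⟩ := ih (k + 1) (by omega)
      have hd1 : dist z (u (k + 1)) ≤ 1 := hd.trans (pow_le_one₀ (by norm_num) (by norm_num))
      have hez : c + 12 ≤ eucl z := by
        have h1 := abs_eucl_sub_le z (u (k + 1))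
        rw [← dist_eq_norm] at h1
        linarith [(abs_le.1 h1).1, hN (k + 1) (by omega)]
      have hzdom : z ∈ branchDomain c (q k) :=
        mem_branchDomain_of_not_even (hodd k hk) (by linarith)
      refine ⟨branch c (q k) z, backwardOrbitInfty_of_preimage (planarT_branch hc hzdom) hz, ?_⟩
      have hb := (branch_of_planarT_eq hc (hq k) (hu k)).2
      calc dist (branch c (q k) z) (u k)
          = dist (branch c (q k) z) (branch c (q k) (u (k + 1))) := by rw [hb]
        _ ≤ 1 / 2 * dist z (u (k + 1)) :=
          dist_branch_le hc (R := c + 12) (by linarith) (by nlinarith) (hodd k hk) hez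
            (by linarith [hN (k + 1) (by omega)])
        _ ≤ (1 / 2) ^ (m + 1) := by rw [pow_succ']; gcongr
  have hclos : u N ∈ closure (backwardOrbitInfty (planarT c)) := by
    rw [Metric.mem_closure_iff]
    intro ε hε
    obtain ⟨m, hm⟩ := exists_pow_lt_of_lt_one hε (by norm_num : (1 / 2 : ℝ) < 1)
    obtain ⟨z, hz, hd⟩ := happrox m N le_rfl
    exact ⟨z, hz, by rw [dist_comm]; exact hd.trans_lt hm⟩
  -- No contraction is available before time `N`; openness of the map carries the approximation back
  -- to `u 0`.
  clear hN hodd happrox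
  induction N with
  | zero => exact hclos
  | succ N ih =>
    exact ih (mem_closure_of_planarT hc (fun _ _ => backwardOrbitInfty_of_preimage) (hu N) hclos)

/-! ### Prescribed itineraries, uncountability and equality of closures -/

/-- Composing branches gives sequences that obey the map for any finite number of steps; the
corresponding nested closed subsets of the compact product of squares have a common point. -/
theorem exists_orbit_of_itinerary (hc : 0 < c) {q : ℕ → ℤ × ℤ}
    (hodd : ∀ k, ¬ Even ((q k).1 + (q k).2)) (hdom : ∀ k, ∀ y ∈ square (q (k + 1)), c ≤ eucl y) :
    ∃ u : ℕ → ℝ × ℝ, (∀ k, u k ∈ square (q k)) ∧ ∀ k, planarT c (u k) = u (k + 1) := by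
  let K : Set (ℕ → ℝ × ℝ) := Set.pi Set.univ fun k => square (q k)
  have hK : IsCompact K := isCompact_univ_pi fun k => isCompact_closedBall _ _
  let B : ℕ → Set (ℕ → ℝ × ℝ) := fun j => {u ∈ K | u j - branch c (q j) (u (j + 1)) ∈ ({0} : Set _)}
  have hB : ∀ j, IsClosed (B j) := by
    intro j
    have hcont : ContinuousOn (fun u : ℕ → ℝ × ℝ => u j - branch c (q j) (u (j + 1))) K := by
      refine (continuous_apply j).continuousOn.sub ((continuousOn_branch hc).comp
        (continuous_apply (j + 1)).continuousOn fun u hu => ?_)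
      exact mem_branchDomain_of_not_even (hodd j) (hdom j _ (hu (j + 1) trivial))
    exact hcont.preimage_isClosed_of_isClosed hK.isClosed isClosed_singleton
  let A : ℕ → Set (ℕ → ℝ × ℝ) := fun n => K ∩ ⋂ j, ⋂ (_ : j < n), B j
  have hA : ∀ n, IsClosed (A n) := fun n =>
    hK.isClosed.inter (isClosed_iInter fun j => isClosed_iInter fun _ => hB j)
  have hne : ∀ n, (A n).Nonempty := by
    intro n
    have : ∀ n (i : ℕ), ∃ u : ℕ → ℝ × ℝ, (∀ k, u k ∈ square (q (i + k))) ∧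
        ∀ j < n, u j = branch c (q (i + j)) (u (j + 1)) := by
      intro n
      induction n with
      | zero =>
        exact fun i => ⟨fun k => center (q (i + k)),
          fun k => Metric.mem_closedBall_self (by positivity), fun j hj => absurd hj (by omega)⟩
      | succ n ih =>
        intro i
        obtain ⟨u, hu, hu'⟩ := ih (i + 1)
        refine ⟨fun k => Nat.casesOn k (branch c (q i) (u 0)) u, fun k => ?_, fun j hj => ?_⟩
        · cases k with
          | zero =>
            exact branch_mem hc (mem_branchDomain_of_not_even (hodd i) (hdom i _ (hu 0)))
          | succ k => exact (show i + 1 + k = i + (k + 1) by ring) ▸ hu k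
        · cases j with
          | zero => rfl
          | succ j =>
            have := hu' j (by omega)
            rwa [show i + 1 + j = i + (j + 1) by ring] at this
    obtain ⟨u, hu, hu'⟩ := this n 0
    simp only [zero_add] at hu hu'
    have huK : u ∈ K := fun k _ => hu k
    refine ⟨u, huK, Set.mem_iInter₂.2 fun j hj => ⟨huK, ?_⟩⟩
    rw [Set.mem_singleton_iff, sub_eq_zero]
    exact hu' j hj
  obtain ⟨u, hu⟩ := IsCompact.nonempty_iInter_of_sequence_nonempty_isCompact_isClosed A
    (fun n u hu => ⟨hu.1, Set.mem_iInter₂.2 fun j hj => Set.mem_iInter₂.1 hu.2 j (by omega)⟩)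
    hne (hK.of_isClosed_subset (hA 0) Set.inter_subset_left) hA
  have huA := Set.mem_iInter.1 hu
  refine ⟨u, fun k => (huA 0).1 k trivial, fun k => ?_⟩
  have h1 := (Set.mem_iInter₂.1 (huA (k + 1)).2 k (by omega)).2
  rw [Set.mem_singleton_iff, sub_eq_zero] at h1
  rw [h1]
  exact planarT_branch hc (mem_branchDomain_of_not_even (hodd k)
    (hdom k _ ((huA 0).1 (k + 1) trivial)))

/-- Itineraries escaping to infinity, one for each binary sequence. -/
def escapingItinerary (N : ℕ) (s : ℕ → Bool) (k : ℕ) : ℤ × ℤ :=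
  (2 * ((k : ℤ) + N) + 1, if s k then 2 else 0)

theorem le_eucl_of_mem_escapingItinerary {N k : ℕ} {s : ℕ → Bool}
    (hy : y ∈ square (escapingItinerary N s k)) : (k : ℝ) + N ≤ eucl y := by
  have h1 : |(y - center (escapingItinerary N s k)).1| ≤ π / 4 := by
    rw [square, Metric.mem_closedBall, dist_eq_norm, norm_eq_max] at hy
    exact (le_max_left _ _).trans hy
  simp only [center, escapingItinerary, Prod.fst_sub] at h1
  push_cast at h1
  have h2 := (abs_le.1 h1).1
  have h3 : y.1 ≤ eucl y := (le_abs_self _).trans ((le_max_left _ _).trans (norm_le_eucl y))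
  have h4 : (0 : ℝ) ≤ k + N := by positivity
  nlinarith [pi_gt_three]

theorem exists_escaping_orbit (hc : 0 < c) {N : ℕ} (hN : c ≤ N) (s : ℕ → Bool) :
    ∃ u : ℕ → ℝ × ℝ, (∀ k, u k ∈ square (escapingItinerary N s k)) ∧
      (∀ k, planarT c (u k) = u (k + 1)) ∧ u 0 ∈ escapingSet (planarT c) := by
  obtain ⟨u, hu, hu'⟩ := exists_orbit_of_itinerary hc (q := escapingItinerary N s)
    (fun k => by
      unfold escapingItinerary
      rw [Int.not_even_iff_odd]
      split_ifs
      · exact ⟨(k : ℤ) + N + 1, by ring⟩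
      · exact ⟨(k : ℤ) + N, by ring⟩)
    (fun k y hy => (hN.trans (by simp; positivity)).trans (le_eucl_of_mem_escapingItinerary hy))
  refine ⟨u, hu, hu', mem_escapingSet_iff.2 ⟨u, rfl, hu', ?_⟩⟩
  rw [← Metric.cobounded_eq_cocompact, ← tendsto_norm_atTop_iff_cobounded]
  have h1 : Tendsto (fun k : ℕ => (k : ℝ) / 2) atTop atTop :=
    tendsto_natCast_atTop_atTop.atTop_div_const two_pos
  refine tendsto_atTop_mono (fun k => ?_) h1
  have h2 := le_eucl_of_mem_escapingItinerary (hu k)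
  have h3 := eucl_le (u k)
  have h4 : (0 : ℝ) ≤ N := by positivity
  linarith

theorem not_countable_escapingSet_planarT (hc : 0 < c) :
    ¬ (escapingSet (planarT c)).Countable := by
  intro hcount
  obtain ⟨N, hN⟩ := exists_nat_ge c
  choose u hu hu' huI using exists_escaping_orbit hc hN
  have hinj : Function.Injective fun s => u s 0 := by
    intro s s' hss
    have horb : u s = u s' := orbit_unique (hu' s) (hu' s') hss
    funext k
    have h1 := hu s k
    have h2 := hu s' k
    rw [← horb] at h2
    by_contra hne
    have h3 : dist (center (escapingItinerary N s k)) (center (escapingItinerary N s' k)) ≤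
        π / 4 + π / 4 :=
      (dist_triangle_left _ _ _).trans (add_le_add h1 h2)
    have h4 : |(center (escapingItinerary N s k)).2 - (center (escapingItinerary N s' k)).2| ≤
        π / 4 + π / 4 := (le_max_right _ _).trans (by rwa [dist_eq_norm, norm_eq_max] at h3)
    have hpi := pi_pos
    -- Different digits give centres at vertical distance `π`, more than the side `π/2`.
    cases hs : s k <;> cases hs' : s' k <;> simp [hs, hs'] at hne <;>
      simp [center, escapingItinerary, hs, hs'] at h4 <;>
      linarith [le_abs_self (π / 2)]
  have : (Set.univ : Set (ℕ → Bool)).Countable :=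
    (hcount.preimage hinj).mono fun s _ => huI s
  rw [Set.countable_univ_iff] at this
  obtain ⟨f, hf⟩ := exists_surjective_nat (ℕ → Bool)
  obtain ⟨n, hn⟩ := hf fun k => !f k k
  simpa using congrFun hn n

theorem closure_escapingSet_planarT (hc : 0 < c) :
    closure (escapingSet (planarT c)) = closure (backwardOrbitInfty (planarT c)) := by
  refine Set.Subset.antisymm (closure_minimal (escapingSet_subset_closure hc) isClosed_closure)
    (closure_minimal (fun x hx => ?_) isClosed_closure)
  refine backwardOrbitInfty_induction (P := fun x => x ∈ closure (escapingSet (planarT c)))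
    (fun x hx => ?_) (fun x y hxy _ hy => ?_) hx
  · refine mem_closure_of_pole hc (fun _ _ => escapingSet_of_preimage) (fun r => ?_) hx
    obtain ⟨N, hN⟩ := exists_nat_ge (max c r)
    obtain ⟨u, hu, -, huI⟩ :=
      exists_escaping_orbit hc ((le_max_left c r).trans hN) fun _ => true
    refine ⟨u 0, huI, ?_⟩
    have := le_eucl_of_mem_escapingItinerary (hu 0)
    rw [Nat.cast_zero, zero_add] at this
    exact ((le_max_right c r).trans hN).trans this
  · exact mem_closure_of_planarT hc (fun _ _ => escapingSet_of_preimage) hxy hy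

/-! ### Total disconnectedness of the planar escaping set -/

theorem isTotallyDisconnected_escapingSet_planarT (hc : 0 < c) :
    IsTotallyDisconnected (escapingSet (planarT c)) := by
  rw [← totallyDisconnectedSpace_subtype_iff]
  choose orb horb0 horb hlim using
    fun x : escapingSet (planarT c) => mem_escapingSet_iff.1 x.2
  have hcont : ∀ k, Continuous fun x => orb x k := by
    intro k
    induction k with
    | zero => simpa only [horb0] using continuous_subtype_val
    | succ k ih =>
      rw [continuous_iff_continuousAt]
      intro x
      obtain ⟨g, hg, hev⟩ := continuousAt_planarT (c := c) (p := orb x k)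
        (by rw [horb]; exact OnePoint.coe_ne_infty _)
      refine (hg.comp (f := fun x => orb x k) ih.continuousAt).congr ?_
      filter_upwards [ih.continuousAt.eventually hev] with x' hx'
      rw [horb, OnePoint.coe_eq_coe] at hx'
      exact hx'.symm
  -- Countably many pieces: the first `n` squares are prescribed, and from time `n` on the orbit
  -- stays where odd branches contract.
  let F : (Σ n, Fin n → ℤ × ℤ) → Set (escapingSet (planarT c)) := fun i =>
    {x | (∀ j : Fin i.1, orb x j ∈ square (i.2 j)) ∧ ∀ k ≥ i.1, c + 12 ≤ eucl (orb x k)}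
  have hF : ∀ i, IsClosed (F i) := by
    intro i
    refine IsClosed.inter ?_ ?_
    · change IsClosed {x | ∀ j : Fin i.1, orb x j ∈ square (i.2 j)}
      rw [Set.ofPred_forall]
      exact isClosed_iInter fun j => Metric.isClosed_closedBall.preimage (hcont j)
    · change IsClosed {x | ∀ k ≥ i.1, c + 12 ≤ eucl (orb x k)}
      simp only [Set.ofPred_forall]
      exact isClosed_iInter fun k => isClosed_iInter fun _ =>
        isClosed_le continuous_const (continuous_eucl.comp (hcont k))
  have hcov : ∀ x, ∃ i, x ∈ F i := by
    intro x
    obtain ⟨N, hN⟩ := eventually_le_eucl (hlim x) (c + 12)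
    choose q hq using fun k => exists_mem_square (orb x k)
    exact ⟨⟨N, fun j => q j⟩, fun j => hq j, hN⟩
  obtain ⟨e, he⟩ := exists_surjective_nat (Σ n, Fin n → ℤ × ℤ)
  refine totallyDisconnectedSpace_of_iUnion_closed (F := fun n => F (e n)) (fun n => hF _)
    (fun x => ?_) (fun n => ?_)
  · obtain ⟨i, hi⟩ := hcov x
    obtain ⟨n, rfl⟩ := he i
    exact ⟨n, hi⟩
  generalize e n = i
  obtain ⟨n, Q⟩ := i
  intro y U hU hyU
  choose q hq using fun k => exists_mem_square (orb y k)
  have hodd : ∀ k ≥ n, ¬ Even ((q k).1 + (q k).2) := fun k hk =>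
    not_even_of_lt_eucl hc (hq k) (horb y k) (by linarith [y.2.2 (k + 1) (Nat.le_succ_of_le hk)])
  -- Cylinders around `y`. Orbits in the piece avoid the critical circle after time `n`, so closed
  -- squares may be replaced by open ones.
  let C : ℕ → Set (F ⟨n, Q⟩) := fun m => {x | ∀ k ∈ Finset.Icc n (n + m), orb x k ∈ square (q k)}
  have hcont' : ∀ k, Continuous fun x : F ⟨n, Q⟩ => orb x k := fun k =>
    (hcont k).comp continuous_subtype_val
  have hCcl : ∀ m, IsClopen (C m) := by
    intro m
    constructor
    · simp only [C, Set.ofPred_forall]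
      exact isClosed_iInter fun k => isClosed_iInter fun _ =>
        Metric.isClosed_closedBall.preimage (hcont' k)
    · have : C m = ⋂ k ∈ Finset.Icc n (n + m),
          (fun x : F ⟨n, Q⟩ => orb x k) ⁻¹' Metric.ball (center (q k)) (π / 4) := by
        ext x
        simp only [C, Set.mem_iInter₂, Set.mem_preimage]
        refine forall₂_congr fun k hk => ⟨fun h => ?_, fun h => Metric.ball_subset_closedBall h⟩
        have hk' : n ≤ k + 1 := Nat.le_succ_of_le (Finset.mem_Icc.1 hk).1
        exact mem_ball_of_eucl_ne hc h (horb x k) (by linarith [x.2.2 (k + 1) hk'])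
      rw [this]
      exact isOpen_biInter_finset fun k _ => Metric.isOpen_ball.preimage (hcont' k)
  by_contra hcon
  push Not at hcon
  have hx := fun m => Set.not_subset.1 (hcon (C m) (hCcl m) fun k _ => hq k)
  choose x hxC hxU using hx
  have hdist : ∀ (z : F ⟨n, Q⟩) (m k : ℕ), n ≤ k →
      (∀ j, k ≤ j → j ≤ k + m → orb z j ∈ square (q j)) →
      dist (orb z k) (orb y k) ≤ (1 / 2) ^ m * 2 := by
    intro z m
    induction m with
    | zero =>
      intro k _ hz
      have h1 : dist (orb z k) (center (q k)) ≤ π / 4 := hz k le_rfl le_rfl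
      have h2 : dist (orb y k) (center (q k)) ≤ π / 4 := hq k
      have h3 := dist_triangle_right (orb z k) (orb y k) (center (q k))
      linarith [pi_le_four]
    | succ m ih =>
      intro k hk hz
      have hk' : n ≤ k + 1 := Nat.le_succ_of_le hk
      have h1 := ih (k + 1) hk' fun j hj hj' => hz j (by omega) (by omega)
      have hbz := (branch_of_planarT_eq hc (hz k le_rfl (by omega)) (horb z k)).2
      have hby := (branch_of_planarT_eq hc (hq k) (horb y k)).2
      calc dist (orb z k) (orb y k)
          = dist (branch c (q k) (orb z (k + 1))) (branch c (q k) (orb y (k + 1))) := by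
            rw [hbz, hby]
        _ ≤ 1 / 2 * dist (orb z (k + 1)) (orb y (k + 1)) :=
          dist_branch_le hc (R := c + 12) (by linarith) (by nlinarith) (hodd k hk)
            (z.2.2 _ hk') (y.2.2 _ hk')
        _ ≤ 1 / 2 * ((1 / 2) ^ m * 2) := by gcongr
        _ = (1 / 2) ^ (m + 1) * 2 := by ring
  have hlim_n : Tendsto (fun m => orb (x m) n) atTop (𝓝 (orb y n)) := by
    rw [tendsto_iff_dist_tendsto_zero]
    refine squeeze_zero (fun _ => dist_nonneg) (fun m => hdist (x m) m n le_rfl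
      fun j hj hj' => hxC m j (Finset.mem_Icc.2 ⟨hj, hj'⟩)) ?_
    simpa using (tendsto_pow_atTop_nhds_zero_of_lt_one (by norm_num : (0 : ℝ) ≤ 1 / 2)
      (by norm_num)).mul_const 2
  -- All points of the piece share the squares `Q` up to time `n`, so continuity of these common
  -- branches suffices here.
  have hlim_0 : Tendsto (fun m => orb (x m) 0) atTop (𝓝 (orb y 0)) := by
    refine Nat.decreasingInduction' (P := fun k => Tendsto (fun m => orb (x m) k) atTop
      (𝓝 (orb y k))) (fun k hk _ ih => ?_) (Nat.zero_le n) hlim_n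
    have hb := fun z : F ⟨n, Q⟩ => branch_of_planarT_eq hc (z.2.1 ⟨k, hk⟩) (horb z k)
    have h1 := (continuousOn_branch hc _ (hb y).1).tendsto.comp
      (tendsto_nhdsWithin_iff.2 ⟨ih, Eventually.of_forall fun m => (hb (x m)).1⟩)
    simpa only [Function.comp_def, (hb _).2] using h1
  simp only [horb0] at hlim_0
  have hlim_y : Tendsto x atTop (𝓝 y) := tendsto_subtype_rng.2 (tendsto_subtype_rng.2 hlim_0)
  obtain ⟨m, hm⟩ := (hlim_y.eventually (hU.mem_nhds hyU)).exists
  exact hxU m hm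

/-! ### Reduction from space to the plane -/

/-- The inclusion of the plane `z = 0`. -/
def planeIncl (p : ℝ × ℝ) : E3 := !₂[p.1, p.2, 0]

theorem isClosedEmbedding_planeIncl : IsClosedEmbedding planeIncl := by
  refine Function.LeftInverse.isClosedEmbedding (f := fun v : E3 => (v 0, v 1)) (fun p => ?_)
    (by fun_prop) ?_
  · simp [planeIncl]
  · unfold planeIncl
    refine (PiLp.continuous_toLp 2 _).comp (continuous_pi fun i => ?_)
    fin_cases i <;> simp <;> fun_prop

theorem mem_range_planeIncl {v : E3} : v ∈ Set.range planeIncl ↔ v 2 = 0 := by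
  constructor
  · rintro ⟨p, rfl⟩
    simp [planeIncl]
  · intro hv
    refine ⟨(v 0, v 1), ?_⟩
    ext i
    fin_cases i <;> simp [planeIncl, hv]

theorem sum_sq_h (a b : ℝ) : (h a b) 0 ^ 2 + (h a b) 1 ^ 2 + (h a b) 2 ^ 2 = 1 := by
  have hsc := sin_sq_add_cos_sq (M a b)
  simp only [h, Matrix.cons_val]
  rcases eq_or_ne (a ^ 2 + b ^ 2) 0 with h0 | h0
  · have ha : a = 0 := by nlinarith [sq_nonneg a, sq_nonneg b]
    have hb : b = 0 := by nlinarith [sq_nonneg a, sq_nonneg b]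
    simp [ha, hb, M]
  · have hsq : √(a ^ 2 + b ^ 2) ^ 2 = a ^ 2 + b ^ 2 := Real.sq_sqrt (by positivity)
    rw [div_pow, div_pow, hsq, mul_pow, mul_pow, ← add_div, ← add_mul, mul_div_cancel_left₀ _ h0,
      hsc]

theorem sum_sq_zorich (v : E3) :
    (zorich v) 0 ^ 2 + (zorich v) 1 ^ 2 + (zorich v) 2 ^ 2 = exp (v 2) ^ 2 := by
  have hs := sum_sq_h (fold (v 0)) (fold (v 1))
  have hsign : ((-1 : ℝ) ^ (foldIndex (v 0) + foldIndex (v 1))) ^ 2 = 1 := by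
    rcases neg_one_zpow_cases (foldIndex (v 0) + foldIndex (v 1)) with h | h <;> simp [h]
  simp only [zorich, PiLp.smul_apply, Matrix.cons_val, smul_eq_mul, mul_pow, hsign]
  linear_combination exp (v 2) ^ 2 * hs

theorem map_smul_eq_infty_iff {c : ℝ} {x : OnePoint E3} :
    OnePoint.map (fun w : E3 => c • w) x = ∞ ↔ x = ∞ := by
  induction x using OnePoint.rec with
  | infty => simp
  | coe y => simp

theorem exp_eq_one_of_sq {z : ℝ} (hz : exp (2 * z) ^ 2 = 1) : z = 0 := by
  rw [← exp_nat_mul, exp_eq_one_iff] at hz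
  simpa using hz

theorem eq_zero_of_scaledT_eq_infty {c : ℝ} {v : E3} (hv : scaledT c v = ∞) : v 2 = 0 := by
  have hT : T v = ∞ := map_smul_eq_infty_iff.1 hv
  rw [T, moebius] at hT
  split_ifs at hT with hZ
  · have hs := sum_sq_zorich ((2 : ℝ) • v)
    rw [hZ] at hs
    simp only [Matrix.cons_val, PiLp.smul_apply, smul_eq_mul] at hs
    exact exp_eq_one_of_sq (by rw [← hs]; norm_num)
  · exact absurd hT (OnePoint.coe_ne_infty _)

/-- The height of an image point, and the position of the image relative to the asymptotic value
`(0, 0, c)`. -/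
theorem scaledT_eq_coe {c : ℝ} {v w : E3} (hv : scaledT c v = w) :
    ∃ D : ℝ, 0 < D ∧ (exp (2 * v 2) - 1) ^ 2 ≤ D ∧ w 2 = c * (exp (2 * v 2) ^ 2 - 1) / D ∧
      w 0 ^ 2 + w 1 ^ 2 + (w 2 - c) ^ 2 = 4 * c ^ 2 / D := by
  rw [scaledT, T, moebius] at hv
  split_ifs at hv with hZ
  · exact absurd hv (OnePoint.infty_ne_coe w)
  have hs := sum_sq_zorich ((2 : ℝ) • v)
  generalize zorich ((2 : ℝ) • v) = Z at *
  rw [PiLp.smul_apply, smul_eq_mul] at hs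
  have hpos := exp_pos (2 * v 2)
  generalize exp (2 * v 2) = E at *
  rw [OnePoint.map_some, OnePoint.coe_eq_coe] at hv
  let D : ℝ := Z 0 ^ 2 + Z 1 ^ 2 + (Z 2 + 1) ^ 2
  have hD : 0 < D := by
    refine lt_of_le_of_ne (by positivity) fun h0 => hZ ?_
    have h0' : Z 0 ^ 2 + Z 1 ^ 2 + (Z 2 + 1) ^ 2 = 0 := h0.symm
    ext i
    fin_cases i
    · simpa using show Z 0 = 0 by nlinarith [sq_nonneg (Z 0), sq_nonneg (Z 1), sq_nonneg (Z 2 + 1)]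
    · simpa using show Z 1 = 0 by nlinarith [sq_nonneg (Z 0), sq_nonneg (Z 1), sq_nonneg (Z 2 + 1)]
    · have : Z 2 + 1 = 0 := by nlinarith [sq_nonneg (Z 0), sq_nonneg (Z 1), sq_nonneg (Z 2 + 1)]
      simpa using show Z 2 = -1 by linarith
  -- `D` is the squared distance from `Z` to the pole of `A`. As `|Z| = E`, it is at least `(E -
  -- 1)²`.
  have hDE : D = E ^ 2 + 2 * Z 2 + 1 := by simp only [D]; linarith
  have hZ2 : -E ≤ Z 2 := (abs_le_of_sq_le_sq' (by nlinarith [sq_nonneg (Z 0), sq_nonneg (Z 1)])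
    hpos.le).1
  have hw0 : w 0 = c * (2 * (1 / D) * Z 0) := by rw [← hv]; simp [D]
  have hw1 : w 1 = c * (2 * (1 / D) * Z 1) := by rw [← hv]; simp [D]
  have hw2 : w 2 = c * (1 - 2 * (1 / D) * (Z 2 + 1)) := by rw [← hv]; simp [D]
  refine ⟨D, hD, by rw [hDE]; nlinarith, ?_, ?_⟩
  · rw [hw2]
    field_simp
    linear_combination c * hDE
  · rw [hw0, hw1, hw2]
    field_simp
    simp only [D]
    ring

/-- On the unit sphere `x² + y² + (z + 1)² = 2 (1 + z)`, so `A` is stereographic projection to the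
plane. -/
theorem scaledT_planeIncl (c : ℝ) (p : ℝ × ℝ) :
    scaledT c (planeIncl p) = OnePoint.map planeIncl (planarT c p) := by
  have hsm : (2 : ℝ) • planeIncl p = !₂[2 * p.1, 2 * p.2, 0] := by
    ext i
    fin_cases i <;> simp [planeIncl]
  have hs := sum_sq_zorich !₂[2 * p.1, 2 * p.2, 0]
  rw [scaledT, T, hsm, moebius, planarT]
  generalize zorich !₂[2 * p.1, 2 * p.2, 0] = Z at *
  simp only [Matrix.cons_val, exp_zero, one_pow] at hs
  by_cases h2 : Z 2 = -1
  · have hZ : Z = !₂[0, 0, -1] := by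
      rw [h2] at hs
      ext i
      fin_cases i
      · simpa using show Z 0 = 0 by nlinarith [sq_nonneg (Z 0), sq_nonneg (Z 1)]
      · simpa using show Z 1 = 0 by nlinarith [sq_nonneg (Z 0), sq_nonneg (Z 1)]
      · simpa using h2
    rw [if_pos hZ, if_pos h2]
    rfl
  · have hZ : Z ≠ !₂[0, 0, -1] := fun hZ => h2 (by rw [hZ]; simp)
    rw [if_neg hZ, if_neg h2]
    have h2' : 1 + Z 2 ≠ 0 := fun h => h2 (by linarith)
    have hD : Z 0 ^ 2 + Z 1 ^ 2 + (Z 2 + 1) ^ 2 = 2 * (1 + Z 2) := by linarith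
    simp only [OnePoint.map_some, OnePoint.coe_eq_coe, hD]
    ext i
    fin_cases i
    · simp [planeIncl]; left; field_simp
    · simp [planeIncl]; left; field_simp
    · simp [planeIncl]; right; field_simp; ring

theorem eq_zero_of_scaledT_eq {c : ℝ} (hc : 0 < c) {v w : E3} (hv : scaledT c v = w)
    (hw : w 2 = 0) : v 2 = 0 := by
  obtain ⟨D, hD, -, h2, -⟩ := scaledT_eq_coe hv
  rw [hw, eq_comm, div_eq_zero_iff, or_iff_left hD.ne', mul_eq_zero, or_iff_right hc.ne',
    sub_eq_zero] at h2
  exact exp_eq_one_of_sq h2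

theorem abs_le_of_abs_exp_sub_one_le {s : ℝ} (hs : |exp s - 1| ≤ 1 / 8) : |s| ≤ 1 / 4 := by
  rw [abs_le] at hs ⊢
  have h1 := add_one_le_exp s
  have h2 := add_one_le_exp (-s)
  have h3 : exp s * exp (-s) = 1 := by rw [← exp_add, add_neg_cancel, exp_zero]
  have h4 := exp_pos (-s)
  constructor
  · nlinarith
  · linarith

theorem half_abs_le_abs_exp_sub_one {s : ℝ} (hs : |s| ≤ 1 / 2) : |s| / 2 ≤ |exp s - 1| := by
  have h1 := abs_exp_sub_one_sub_id_le (x := s) (by linarith)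
  have h2 := abs_sub_abs_le_abs_sub s (s - (exp s - 1))
  rw [sub_sub_cancel, ← abs_neg (s - (exp s - 1)), neg_sub] at h2
  rw [← sq_abs] at h1
  nlinarith [abs_nonneg s]

/-- A point with a distant image is close to the plane `z = 0`, and the map expands the height. -/
theorem height_of_scaledT_eq {c : ℝ} (hc : 0 < c) {v w : E3} (hv : scaledT c v = w)
    (hw : 2 * c + (4 * c + 256 * c ^ 2) + 1 ≤ ‖w‖) : |v 2| ≤ 1 / 8 ∧ 2 * |v 2| ≤ |w 2| := by
  obtain ⟨D, hD, hED, h2, hQ⟩ := scaledT_eq_coe hv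
  -- The summand `256c²` forces `D ≤ 1/64`, hence `|exp (2 v₂) - 1| ≤ 1/8`; the summand `4c` forces
  -- `c / D ≥ 1`, which preserves the growth of `exp (4 v₂) - 1`.
  have hQlarge : 4 * c + 256 * c ^ 2 ≤ 4 * c ^ 2 / D := by
    have hn : ‖w‖ ^ 2 = w 0 ^ 2 + w 1 ^ 2 + w 2 ^ 2 := by
      rw [EuclideanSpace.real_norm_sq_eq, Fin.sum_univ_three]
    have hle : w 2 ≤ ‖w‖ := (le_abs_self _).trans
      (abs_le_of_sq_le_sq (by nlinarith [sq_nonneg (w 0), sq_nonneg (w 1)]) (norm_nonneg w))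
    have hpos : 0 ≤ 4 * c + 256 * c ^ 2 := by positivity
    rw [← hQ]
    nlinarith [mul_le_mul_of_nonneg_left hle hc.le, norm_nonneg w]
  have hD1 : D ≤ 1 / 64 := by
    rw [le_div_iff₀ hD] at hQlarge
    have h3 : 256 * c ^ 2 * D ≤ 4 * c ^ 2 := by nlinarith [mul_pos hc hD]
    have h4 : 0 < c ^ 2 := by positivity
    nlinarith
  have hE : |exp (2 * v 2) - 1| ≤ 1 / 8 := abs_le_of_sq_le_sq (by linarith) (by norm_num)
  have hz := abs_le_of_abs_exp_sub_one_le hE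
  rw [abs_mul, abs_two] at hz
  refine ⟨by linarith, ?_⟩
  have hexp : exp (2 * v 2) ^ 2 = exp (4 * v 2) := by
    rw [← exp_nat_mul]; congr 1; push_cast; ring
  have habs4 : |4 * v 2| = 4 * |v 2| := by rw [abs_mul, abs_of_pos (by norm_num : (0 : ℝ) < 4)]
  have hgrow := half_abs_le_abs_exp_sub_one (s := 4 * v 2) (by rw [habs4]; linarith)
  have hcD : 1 ≤ c / D := by
    rw [le_div_iff₀ hD] at hQlarge
    rw [le_div_iff₀ hD, one_mul]
    have h3 : 4 * c * D ≤ 4 * c ^ 2 := by nlinarith [mul_pos (pow_pos hc 2) hD]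
    nlinarith
  rw [h2, hexp, mul_div_right_comm, abs_mul, abs_of_pos (by positivity : 0 < c / D)]
  nlinarith [abs_nonneg (exp (4 * v 2) - 1)]

/-- Eventually heights at least double yet stay below `1/8`, so they vanish; backward invariance of
the plane handles earlier times. -/
theorem escaping_orbit_height_eq_zero {c : ℝ} (hc : 0 < c) {u : ℕ → E3}
    (hu : ∀ k, scaledT c (u k) = u (k + 1)) (hlim : Tendsto u atTop (cocompact E3)) (k : ℕ) :
    u k 2 = 0 := by
  obtain ⟨N, hN⟩ := eventually_atTop.1 ((tendsto_norm_cocompact_atTop.comp hlim).eventually_ge_atTop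
    (2 * c + (4 * c + 256 * c ^ 2) + 1))
  have hback : ∀ k m, u (k + m) 2 = 0 → u k 2 = 0 := by
    intro k m
    induction m with
    | zero => exact id
    | succ m ih => exact fun h => ih (eq_zero_of_scaledT_eq hc (hu (k + m)) h)
  have hheight : ∀ k ≥ N, |u k 2| ≤ 1 / 8 ∧ 2 * |u k 2| ≤ |u (k + 1) 2| := fun k hk =>
    height_of_scaledT_eq hc (hu k) (hN (k + 1) (by omega))
  refine hback k N ?_
  have hexpand : ∀ m, 2 ^ m * |u (k + N) 2| ≤ |u (k + N + m) 2| := by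
    intro m
    induction m with
    | zero => simp
    | succ m ih =>
      have := (hheight (k + N + m) (by omega)).2
      rw [pow_succ']
      calc 2 * 2 ^ m * |u (k + N) 2| = 2 * (2 ^ m * |u (k + N) 2|) := by ring
        _ ≤ 2 * |u (k + N + m) 2| := by gcongr
        _ ≤ _ := this
  by_contra hne
  obtain ⟨m, hm⟩ := pow_unbounded_of_one_lt (1 / |u (k + N) 2|) (one_lt_two (α := ℝ))
  rw [div_lt_iff₀ (abs_pos.2 hne)] at hm
  linarith [hexpand m, (hheight (k + N + m) (by omega)).1]

theorem backwardOrbitInfty_scaledT {c : ℝ} (hc : 0 < c) :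
    backwardOrbitInfty (scaledT c) = planeIncl '' backwardOrbitInfty (planarT c) :=
  backwardOrbitInfty_eq_image (scaledT_planeIncl c)
    (fun _ hv => mem_range_planeIncl.2 (eq_zero_of_scaledT_eq_infty hv))
    (fun _ p hv => mem_range_planeIncl.2
      (eq_zero_of_scaledT_eq hc hv (mem_range_planeIncl.1 ⟨p, rfl⟩)))
    isClosedEmbedding_planeIncl.injective

theorem escapingSet_scaledT {c : ℝ} (hc : 0 < c) :
    escapingSet (scaledT c) = planeIncl '' escapingSet (planarT c) :=
  escapingSet_eq_image (scaledT_planeIncl c) isClosedEmbedding_planeIncl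
    fun _ hu hlim k => mem_range_planeIncl.2 (escaping_orbit_height_eq_zero hc hu hlim k)

/-- Two disjoint sets with the same closure in a `T1` space have no isolated points. -/
theorem accPt_of_closure_eq {X : Type*} [TopologicalSpace X] [T1Space X] {A B : Set X}
    (hAB : closure A = closure B) (hdisj : Disjoint A B) {x : X} (hx : x ∈ A) :
    AccPt x (𝓟 A) := by
  rw [accPt_iff_nhds]
  intro U hU
  obtain ⟨V, hVU, hV, hxV⟩ := mem_nhds_iff.1 hU
  obtain ⟨b, hbV, hb⟩ := mem_closure_iff.1 (hAB ▸ subset_closure hx : x ∈ closure B) V hV hxV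
  have hbx : b ≠ x := fun h => Set.disjoint_left.1 hdisj hx (h ▸ hb)
  -- The detour through `b ≠ x` allows `x` to be removed from the neighbourhood before returning to
  -- `A`.
  obtain ⟨a, ⟨haV, hax⟩, ha⟩ := mem_closure_iff.1 (hAB ▸ subset_closure hb : b ∈ closure A)
    (V ∩ {x}ᶜ) (hV.inter isOpen_compl_singleton) ⟨hbV, hbx⟩
  exact ⟨a, ⟨hVU haV, ha⟩, hax⟩

end QRTangent

end

theorem theorem2p2 (lam : ℝ) (hlam : 0 < lam) :
    closure (QRTangent.escapingSet (QRTangent.scaledT lam)) =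
        closure (QRTangent.backwardOrbitInfty (QRTangent.scaledT lam)) ∧
      ¬ (QRTangent.escapingSet (QRTangent.scaledT lam)).Countable ∧
      IsTotallyDisconnected (QRTangent.escapingSet (QRTangent.scaledT lam)) ∧
      ∀ x ∈ QRTangent.escapingSet (QRTangent.scaledT lam),
        AccPt x (𝓟 (QRTangent.escapingSet (QRTangent.scaledT lam))) := by
  have hemb := QRTangent.isClosedEmbedding_planeIncl
  have hclos : closure (QRTangent.escapingSet (QRTangent.scaledT lam)) =
      closure (QRTangent.backwardOrbitInfty (QRTangent.scaledT lam)) := by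
    rw [QRTangent.escapingSet_scaledT hlam, QRTangent.backwardOrbitInfty_scaledT hlam,
      hemb.closure_image_eq, hemb.closure_image_eq, QRTangent.closure_escapingSet_planarT hlam]
  refine ⟨hclos, ?_, ?_, fun x hx => QRTangent.accPt_of_closure_eq hclos
    (Set.disjoint_left.2 fun y hy => hy.1) hx⟩
  · rw [QRTangent.escapingSet_scaledT hlam]
    exact fun hcount => QRTangent.not_countable_escapingSet_planarT hlam
      (Set.countable_of_injective_of_countable_image hemb.injective.injOn hcount)
  · rw [QRTangent.escapingSet_scaledT hlam, hemb.isEmbedding.isTotallyDisconnected_image]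
    exact QRTangent.isTotallyDisconnected_escapingSet_planarT hlam
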